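/- Let $P_v=\mathcal N(v,\sigma^2 I_d)$ with $v\in\mathbb R^d$, $\sigma\in(0,1]$, and write $n=\sigma^{-2}$, i.e. $\sigma=1/\sqrt n$. From one observation $X\sim P_v$ one tests $H_0:\|v\|_1\le\epsilon_0$ against $H_1:\|v\|_1\ge\epsilon_1$. Fix $\alpha,\beta>0$ with $\alpha+\beta<1$. A test is a measurable map $\psi:\mathbb R^d\to\{0,1\}$; it is valid if $\sup_{\|v\|_1\le\epsilon_0}P_v(\psi=1)\le\alpha$, and its risk is $\sup_{\|v\|_1\ge\epsilon_1}P_v(\psi=0)$. Let $R_*(\epsilon_0,\epsilon_1)$ be the infimum of the risk over all valid tests, and define the critical separation $$s(\epsilon_0)=\inf\{\epsilon_1-\epsilon_0:\ \epsilon_1\ge\epsilon_0,\ R_*(\epsilon_0,\epsilon_1)<\beta\}.$$ The plug-in test is $$\psi_1(X)=I\Big(T_1(X)\ge\sup_{\|v\|_1\le\epsilon_0}q_{1-\alpha}(T_1,P_v)\Big),\qquad T_1(X)=\|X\|_1-E_{P_0}\|X\|_1,$$ where $q_{1-\alpha}(T_1,P_v)$ is the $(1-\alpha)$-quantile of $T_1(X)$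 under $X\sim P_v$. **Theorem.** There is an absolute exponent $\kappa\ge 0$ such that for all $\alpha,\beta>0$ with $\alpha+\beta<1$ and all $a,b>0$ there is a constant $C>0$, depending only on $(\alpha,\beta,a,b)$, such that for all $d\ge2$, all $\sigma\in(0,1]$ and all $\epsilon_0$: 1. (Interpolation regime) if $a\sqrt{d/n}\le\epsilon_0\le b\,d/\sqrt n$, then $$\frac{1}{C(\log d)^{\kappa}}\sqrt{\epsilon_0\cdot\frac{d}{\sqrt n}}\ \le\ s(\epsilon_0)\ \le\ C\sqrt{\epsilon_0\cdot\frac{d}{\sqrt n}},$$ and the plug-in test is valid and has risk less than $\beta$ whenever $\epsilon_1-\epsilon_0\ge C\sqrt{\epsilon_0\, d/\sqrt n}$. 2. (Functional estimation regime) if $a\,d/\sqrt n\le\epsilon_0\le b\,d/\sqrt n$, then $$\frac{1}{C(\log d)^{\kappa}}\cdot\frac{d}{\sqrt n}\ \le\ s(\epsilon_0)\ \le\ C\,\frac{d}{\sqrt n},$$ and the plug-in test is valid and has risk less than $\beta$ whenever $\epsilon_1-\epsilon_0\ge C\,d/\sqrt n$. -/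

import Mathlib

open MeasureTheory ProbabilityTheory
open scoped ENNReal

namespace TolerantTesting

noncomputable section

/-- The `ℓ₁` norm of a vector of `ℝ^d`. -/
def l1norm {d : ℕ} (v : Fin d → ℝ) : ℝ := ∑ i, |v i|

/-- The Gaussian sequence model `P_v = N(v, σ² I_d)`: independent coordinates
`X_i ∼ N(v_i, σ²)`. -/
def gaussianSeq {d : ℕ} (σ : ℝ) (v : Fin d → ℝ) : Measure (Fin d → ℝ) :=
  Measure.pi fun i => gaussianReal (v i) (σ ^ 2).toNNReal

/-- Valid tests for `H₀ : ‖v‖₁ ≤ ε₀`: measurable maps of the sample space to `{0, 1}` whose type-I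
error is at most `α`. -/
def IsValidTest {d : ℕ} (σ α ε₀ : ℝ) (ψ : (Fin d → ℝ) → Fin 2) : Prop :=
  Measurable ψ ∧
    ∀ v : Fin d → ℝ, l1norm v ≤ ε₀ → gaussianSeq σ v {x | ψ x = 1} ≤ ENNReal.ofReal α

/-- The risk of a test: its largest type-II error over `H₁ : ‖v‖₁ ≥ ε₁`. -/
def testRisk {d : ℕ} (σ ε₁ : ℝ) (ψ : (Fin d → ℝ) → Fin 2) : ℝ≥0∞ :=
  ⨆ (v : Fin d → ℝ) (_ : ε₁ ≤ l1norm v), gaussianSeq σ v {x | ψ x = 0}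

/-- The minimax risk: the smallest risk over all valid tests. -/
def minimaxRisk (d : ℕ) (σ α ε₀ ε₁ : ℝ) : ℝ≥0∞ :=
  ⨅ (ψ : (Fin d → ℝ) → Fin 2) (_ : IsValidTest σ α ε₀ ψ), testRisk σ ε₁ ψ

/-- The critical separation `ε₁*(ε₀) - ε₀`: the infimum of `ε₁ - ε₀` over all `ε₁ ≥ ε₀` with
minimax risk below `β`. -/
def criticalSeparation (d : ℕ) (σ α β ε₀ : ℝ) : ℝ :=
  sInf {s : ℝ | ∃ ε₁ : ℝ, ε₀ ≤ ε₁ ∧ minimaxRisk d σ α ε₀ ε₁ < ENNReal.ofReal β ∧ s = ε₁ - ε₀}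

/-- The `q`-quantile of the statistic `T(X)` when `X ∼ P`. -/
def quantile {d : ℕ} (q : ℝ) (T : (Fin d → ℝ) → ℝ) (P : Measure (Fin d → ℝ)) : ℝ :=
  sInf {t : ℝ | ENNReal.ofReal q ≤ P {x | T x ≤ t}}

/-- The plug-in statistic `T₁(X) = ‖X‖₁ - E_{P₀} ‖X‖₁`. -/
def plugInStat {d : ℕ} (σ : ℝ) (x : Fin d → ℝ) : ℝ :=
  l1norm x - ∫ y, l1norm y ∂(gaussianSeq σ (0 : Fin d → ℝ))

/-- The threshold `sup_{‖v‖₁ ≤ ε₀} q_{1-α}(T₁, P_v)`. -/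
def plugInThreshold (d : ℕ) (σ α ε₀ : ℝ) : ℝ :=
  sSup {t : ℝ | ∃ v : Fin d → ℝ, l1norm v ≤ ε₀ ∧
    t = quantile (1 - α) (plugInStat σ) (gaussianSeq σ v)}

open Classical in
/-- The calibrated plug-in test: reject when `T₁(X)` reaches the threshold. -/
def plugInTest (d : ℕ) (σ α ε₀ : ℝ) (x : Fin d → ℝ) : Fin 2 :=
  if plugInThreshold d σ α ε₀ ≤ plugInStat σ x then 1 else 0

end

end TolerantTesting

namespace TolerantTesting

/-! ### Moment matching -/

/-! Upper bound. Under `P_v` the plug-in statistic has mean `∑ h(v_i)`, where `h(u) = E|u + σξ| -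
E|σξ|` and `ξ` is standard normal. Always `h(u) ≤ |u|`, while `h(u)` is at least a constant times
`min(|u|, u²/σ)`. The latter dominates each line `l|u| - l²σ` with `0 ≤ l ≤ 1`, so the mean is at
least a constant times `l‖v‖₁ - l²σd`, however `v` spreads its mass
(`exists_mul_le_integral_abs_sub`). Taking `l` of order `√(ε₀/(σd))` makes this exceed any
prescribed multiple of `ε₀` once `‖v‖₁ - ε₀` is a large multiple of `√(ε₀σd)`. The standard
deviation is at most `σ√d`, hence of order at most `ε₀`, and Chebyshev's inequality controls both
errors.

Lower bound. Draw the coordinates independently as `σu`, with `u` from one of two priors on `[-1,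
1]` sharing `2N` moments (`exists_moment_matching`). Under the null prior `E|u| ≤ 4Nη²`; under the
alternative prior `|u| ≥ η/N` surely. One total is quadratic in `η` and the other linear, which
produces the square root: `η` of order `√(ε₀/(σd))/N²` separates the norms by order `√(ε₀σd)/N³`.
Matched moments make each coordinate's two Gaussian mixtures exponentially close in `N`
(`sum_mul_lintegral_gaussianReal_le`), and the errors add over coordinates
(`sum_prod_mul_lintegral_pi_le`). Thus `N` of order `log d` suffices, whence the exponent 3. A
further coordinate, fixed just below `ε₀`, brings the null prior to the boundary of the null;
Markov's inequality and the mixture error each cost a quarter of the slack `1 - α - β`.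

The functional estimation regime is the case where `ε₀` has order `σd`. -/

theorem neg_one_pow_two_mul_sub {N k : ℕ} (hk : k ≤ 2 * N) :
    (-1 : ℝ) ^ (2 * N - k) = (-1) ^ k := by
  rcases Nat.even_or_odd k with he | ho
  · rw [he.neg_one_pow, Even.neg_one_pow]
    obtain ⟨r, rfl⟩ := he
    exact ⟨N - r, by omega⟩
  · rw [ho.neg_one_pow, Odd.neg_one_pow]
    obtain ⟨r, rfl⟩ := ho
    exact ⟨N - r - 1, by omega⟩

/-- The `2N`-th finite difference annihilates polynomials of degree below `2N`. -/
theorem sum_alternating_choose_mul_pow (N m : ℕ) (hm : m < 2 * N) :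
    ∑ k ∈ Finset.range (2 * N + 1), (-1 : ℝ) ^ k * (2 * N).choose k * ((k : ℝ) - N) ^ m = 0 := by
  have h := fwdDiff_iter_eq_sum_shift (h := (1 : ℝ)) (fun r : ℝ => r ^ m) (2 * N) (-(N : ℝ))
  rw [fwdDiff_iter_pow_eq_zero_of_lt hm] at h
  rw [Pi.zero_apply] at h
  rw [h]
  refine Finset.sum_congr rfl fun k hk => ?_
  have hk' : k ≤ 2 * N := by simpa [Nat.lt_succ_iff] using hk
  have hs : (-1 : ℝ) ^ (2 * N - k) = (-1) ^ k := neg_one_pow_two_mul_sub hk'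
  rw [zsmul_eq_mul]
  push_cast
  rw [hs]
  congr 2
  simp
  ring

/-- Interpolation weights at the integer nodes `k - N`, `0 ≤ k ≤ 2N`. The sum of
`weight N t k * (p (k - N) - p (√t))` vanishes for every even polynomial of degree at most `2N`. -/
noncomputable def weight (N : ℕ) (t : ℝ) (k : ℕ) : ℝ :=
  (-1) ^ k * (2 * N).choose k * (t / (((k : ℝ) - N) ^ 2 - t)) / ((-1) ^ N * (2 * N).choose N)

theorem weight_self (N : ℕ) {t : ℝ} (ht : 0 < t) : weight N t N = -1 := by
  have h1 : ((2 * N).choose N : ℝ) ≠ 0 := by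
    exact_mod_cast (Nat.choose_pos (by omega)).ne'
  have h2 : ((-1 : ℝ)) ^ N ≠ 0 := by simp
  unfold weight
  have h3 : t / (((N : ℝ) - N) ^ 2 - t) = -1 := by
    rw [sub_self, div_eq_iff] <;> [ring; (ring_nf; simp [ht.ne'])]
  rw [h3]
  field_simp

theorem one_le_sq_sub {k N : ℕ} (h : k ≠ N) : 1 ≤ ((k : ℝ) - N) ^ 2 := by
  have : (1 : ℤ) ≤ ((k : ℤ) - N) ^ 2 := by
    have : (k : ℤ) - N ≠ 0 := by omega
    have := sq_pos_of_ne_zero this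
    omega
  exact_mod_cast this

/-- Normalising by the central binomial coefficient, the largest one, leaves only the factor `t /
((k - N)² - t)`, and its denominator is at least `3/4`. -/
theorem abs_weight_le (N : ℕ) {t : ℝ} (ht : 0 < t) (ht4 : t ≤ 1 / 4) {k : ℕ} (hk : k ≠ N) :
    |weight N t k| ≤ 2 * t := by
  have h1 : (0 : ℝ) < (2 * N).choose N := by
    exact_mod_cast Nat.choose_pos (by omega)
  have h2 : ((2 * N).choose k : ℝ) ≤ (2 * N).choose N := by
    exact_mod_cast Nat.choose_le_centralBinom k N
  have h3 := one_le_sq_sub hk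
  have h4 : 0 < ((k : ℝ) - N) ^ 2 - t := by linarith
  unfold weight
  rw [abs_div, abs_mul, abs_mul, abs_mul, abs_pow, abs_pow, abs_neg, abs_one, one_pow, one_pow,
    one_mul, one_mul, abs_of_pos h1, Nat.abs_cast, abs_of_pos (div_pos ht h4), div_le_iff₀ h1]
  have h5 : t / (((k : ℝ) - N) ^ 2 - t) ≤ 2 * t := by
    rw [div_le_iff₀ h4]; nlinarith
  calc _ ≤ ((2 * N).choose N : ℝ) * (2 * t) := by
        gcongr
    _ = _ := by ring

/-- The denominator of the weight divides `((k - N)²)^r - t^r`; the quotient has degree below `2N`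
in `k`, so the alternating sum kills it. -/
theorem sum_weight_mul_even_pow (N : ℕ) {t : ℝ} (ht : 0 < t) (ht4 : t ≤ 1 / 4) {r : ℕ}
    (hr : r ≤ N) :
    ∑ k ∈ Finset.range (2 * N + 1), weight N t k * (((k : ℝ) - N) ^ (2 * r) - t ^ r) = 0 := by
  have key : ∀ k ∈ Finset.range (2 * N + 1), weight N t k * (((k : ℝ) - N) ^ (2 * r) - t ^ r) =
      ∑ a ∈ Finset.range r, (t / ((-1) ^ N * (2 * N).choose N) * t ^ (r - 1 - a)) *
        ((-1 : ℝ) ^ k * (2 * N).choose k * ((k : ℝ) - N) ^ (2 * a)) := by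
    intro k _
    have hne : ((k : ℝ) - N) ^ 2 - t ≠ 0 := by
      rcases eq_or_ne k N with rfl | h
      · rw [sub_self]; intro h; nlinarith
      · have := one_le_sq_sub h; intro h; linarith
    have hg := geom_sum₂_mul (((k : ℝ) - N) ^ 2) t r
    rw [pow_mul, ← hg]
    unfold weight
    simp_rw [pow_mul]
    rw [Finset.sum_mul, Finset.mul_sum]
    refine Finset.sum_congr rfl fun a _ => ?_
    field_simp
  rw [Finset.sum_congr rfl key, Finset.sum_comm]
  refine Finset.sum_eq_zero fun a ha => ?_
  have := Finset.mem_range.1 ha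
  rw [← Finset.mul_sum, sum_alternating_choose_mul_pow N (2 * a) (by omega), mul_zero]

/-- The weights are symmetric under `k ↦ 2N - k`, and odd powers change sign. -/
theorem sum_weight_mul_odd_pow (N : ℕ) (t : ℝ) {m : ℕ} (hm : Odd m) :
    ∑ k ∈ Finset.range (2 * N + 1), weight N t k * ((k : ℝ) - N) ^ m = 0 := by
  have h := Finset.sum_range_reflect (fun k => weight N t k * ((k : ℝ) - N) ^ m) (2 * N + 1)
  have h2 : ∑ j ∈ Finset.range (2 * N + 1), weight N t (2 * N + 1 - 1 - j) *
      (((2 * N + 1 - 1 - j : ℕ) : ℝ) - N) ^ m =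
      - ∑ k ∈ Finset.range (2 * N + 1), weight N t k * ((k : ℝ) - N) ^ m := by
    rw [← Finset.sum_neg_distrib]
    refine Finset.sum_congr rfl fun k hk => ?_
    have hk' : k ≤ 2 * N := by simpa [Nat.lt_succ_iff] using hk
    have hc : ((2 * N + 1 - 1 - k : ℕ) : ℝ) - N = -((k : ℝ) - N) := by
      rw [Nat.add_sub_cancel, Nat.cast_sub hk']; push_cast; ring
    have hs : (-1 : ℝ) ^ (2 * N - k) = (-1) ^ k := neg_one_pow_two_mul_sub hk'
    have hw : weight N t (2 * N + 1 - 1 - k) = weight N t k := by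
      unfold weight
      rw [hc, neg_sq, Nat.add_sub_cancel, hs, Nat.choose_symm hk']
    rw [hc, hw, hm.neg_pow]
    ring
  linarith

/-- Two priors on `[-1, 1]` whose first `2N` moments agree: the first has a small first absolute
moment, the second is supported away from the origin. -/
theorem exists_moment_matching (N : ℕ) (hN : 1 ≤ N) (η : ℝ) (hη : 0 < η)
    (hNη : 4 * N * η ^ 2 ≤ 1) :
    ∃ u w₀ w₁ : Fin (2 * N + 1) ⊕ Bool → ℝ,
      (∀ i, 0 ≤ w₀ i) ∧ (∀ i, 0 ≤ w₁ i) ∧ ∑ i, w₀ i = 1 ∧ ∑ i, w₁ i = 1 ∧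
      (∀ i, |u i| ≤ 1) ∧ (∀ m ≤ 2 * N, ∑ i, w₀ i * u i ^ m = ∑ i, w₁ i * u i ^ m) ∧
      ∑ i, w₀ i * |u i| ≤ 4 * N * η ^ 2 ∧ ∀ i, w₁ i ≠ 0 → η / N ≤ |u i| := by
  have hN0 : (0 : ℝ) < N := by exact_mod_cast hN
  have hN1 : (1 : ℝ) ≤ N := by exact_mod_cast hN
  set t : ℝ := η ^ 2 with ht
  have ht0 : 0 < t := by positivity
  have ht4 : t ≤ 1 / 4 := by nlinarith
  have hη1 : η ≤ 1 := by nlinarith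
  set c : ℕ → ℝ := weight N t with hc
  have hcN : c N = -1 := weight_self N ht0
  have hck : ∀ k, k ≠ N → |c k| ≤ 2 * t := fun k hk => abs_weight_le N ht0 ht4 hk
  have hNmem : N ∈ Finset.range (2 * N + 1) := by simp; omega
  set A : ℝ := ∑ k ∈ (Finset.range (2 * N + 1)).erase N, |c k| with hA
  have hA1 : A ≤ 4 * N * t := by
    calc A ≤ ∑ k ∈ (Finset.range (2 * N + 1)).erase N, 2 * t :=
          Finset.sum_le_sum fun k hk => hck k (Finset.ne_of_mem_erase hk)
      _ = 4 * N * t := by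
          rw [Finset.sum_const, Finset.card_erase_of_mem hNmem, Finset.card_range, nsmul_eq_mul]
          push_cast; ring
  set B : ℝ := ∑ k ∈ Finset.range (2 * N + 1), |c k| with hB
  set S : ℝ := ∑ k ∈ Finset.range (2 * N + 1), c k with hS
  have hBA : B = 1 + A := by
    rw [hB, ← Finset.add_sum_erase _ _ hNmem, hcN]; simp [hA]
  have hSA : S ≤ -1 + A := by
    rw [hS, ← Finset.add_sum_erase _ _ hNmem, hcN, hA]
    gcongr
    exact le_abs_self _
  have hA0 : 0 ≤ A := Finset.sum_nonneg fun _ _ => abs_nonneg _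
  have hS0 : S ≤ 0 := by linarith
  have hD2 : 2 ≤ B - S := by linarith
  have hD : 0 < B - S := by linarith
  have hsum : ∀ (f : ℕ → ℝ) (b : Bool → ℝ),
      ∑ i : Fin (2 * N + 1) ⊕ Bool, Sum.elim (fun k : Fin (2 * N + 1) => f k) b i =
        ∑ k ∈ Finset.range (2 * N + 1), f k + (b true + b false) := by
    intro f b
    rw [Fintype.sum_sum_type, Finset.sum_range]
    simp
  -- The signed measure with mass `c k` at `(k - N)/N` and `-S/2` at each of `±η/N` annihilates
  -- degrees up to `2N`. Its normalised negative part is `w₀` and its positive part `w₁`. Since `c N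
  -- = -1`, the origin is charged by `w₀` only; since `S ≤ 0`, the points `±η/N` belong to `w₁`.
  refine ⟨Sum.elim (fun k => (((k : ℕ) : ℝ) - N) / N) (fun b => if b then η / N else -(η / N)),
    Sum.elim (fun k => (|c k| - c k) / (B - S)) (fun _ => 0),
    Sum.elim (fun k => (|c k| + c k) / (B - S)) (fun _ => -S / (B - S)), ?_, ?_, ?_, ?_, ?_, ?_,
    ?_, ?_⟩
  · rintro (k | b)
    · exact div_nonneg (sub_nonneg.2 (le_abs_self _)) hD.le
    · simp
  · rintro (k | b)
    · exact div_nonneg (by have := neg_abs_le (c k); linarith) hD.le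
    · exact div_nonneg (by linarith) hD.le
  · rw [hsum (fun k => (|c k| - c k) / (B - S)), ← Finset.sum_div, Finset.sum_sub_distrib]
    simp [← hB, ← hS, div_self hD.ne']
  · rw [hsum (fun k => (|c k| + c k) / (B - S)), ← Finset.sum_div, Finset.sum_add_distrib]
    rw [← hB, ← hS]
    field_simp
    ring
  · rintro (k | b)
    · simp only [Sum.elim_inl]
      rw [abs_div, abs_of_pos hN0, div_le_one hN0, abs_le]
      have : (k : ℕ) ≤ 2 * N := by omega
      have : ((k : ℕ) : ℝ) ≤ 2 * N := by exact_mod_cast this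
      have : (0 : ℝ) ≤ (k : ℕ) := by positivity
      constructor <;> linarith
    · have : |η / N| ≤ 1 := by
        rw [abs_of_pos (by positivity), div_le_one hN0]; linarith
      cases b <;> simpa using this
  · intro m hm
    have e0 : ∀ i : Fin (2 * N + 1) ⊕ Bool,
        (Sum.elim (fun k : Fin (2 * N + 1) => (|c k| - c k) / (B - S)) (fun _ => 0) i : ℝ) *
        (Sum.elim (fun k : Fin (2 * N + 1) => (((k : ℕ) : ℝ) - N) / N)
          (fun b : Bool => if b then η / N else -(η / N)) i : ℝ) ^ m =
        Sum.elim (fun k : Fin (2 * N + 1) =>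
          (|c k| - c k) / (B - S) * ((((k : ℕ) : ℝ) - N) / N) ^ m)
          (fun _ => 0) i := by
      rintro (k | b) <;> simp
    have e1 : ∀ i : Fin (2 * N + 1) ⊕ Bool,
        (Sum.elim (fun k : Fin (2 * N + 1) => (|c k| + c k) / (B - S))
          (fun _ => -S / (B - S)) i : ℝ) *
        (Sum.elim (fun k : Fin (2 * N + 1) => (((k : ℕ) : ℝ) - N) / N)
          (fun b : Bool => if b then η / N else -(η / N)) i : ℝ) ^ m =
        Sum.elim (fun k : Fin (2 * N + 1) =>
          (|c k| + c k) / (B - S) * ((((k : ℕ) : ℝ) - N) / N) ^ m)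
          (fun b : Bool => -S / (B - S) * (if b then η / N else -(η / N)) ^ m) i := by
      rintro (k | b) <;> simp
    rw [Finset.sum_congr rfl fun i _ => e0 i, Finset.sum_congr rfl fun i _ => e1 i,
      hsum (fun k => (|c k| - c k) / (B - S) * (((k : ℝ) - N) / N) ^ m),
      hsum (fun k => (|c k| + c k) / (B - S) * (((k : ℝ) - N) / N) ^ m)]
    have hdiff : ∑ k ∈ Finset.range (2 * N + 1), (|c k| + c k) / (B - S) * (((k : ℝ) - N) / N) ^ m -
        ∑ k ∈ Finset.range (2 * N + 1), (|c k| - c k) / (B - S) * (((k : ℝ) - N) / N) ^ m =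
        2 / ((B - S) * N ^ m) * ∑ k ∈ Finset.range (2 * N + 1), c k * ((k : ℝ) - N) ^ m := by
      rw [← Finset.sum_sub_distrib, Finset.mul_sum]
      refine Finset.sum_congr rfl fun k _ => ?_
      rw [div_pow]
      field_simp
      ring
    have hm' : ∑ k ∈ Finset.range (2 * N + 1), c k * ((k : ℝ) - N) ^ m =
        S * ((η ^ m + (-η) ^ m) / 2) := by
      rcases Nat.even_or_odd m with he | ho
      · obtain ⟨r, hr⟩ := he.two_dvd
        have h := sum_weight_mul_even_pow N ht0 ht4 (r := r) (by omega)
        simp_rw [mul_sub] at h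
        rw [Finset.sum_sub_distrib, ← Finset.sum_mul] at h
        rw [he.neg_pow, hr, pow_mul η, ← ht, hS]
        linarith
      · rw [ho.neg_pow, hc, sum_weight_mul_odd_pow N t ho]
        ring
    have hfin : 2 / ((B - S) * N ^ m) * (S * ((η ^ m + (-η) ^ m) / 2)) =
        -(-S / (B - S) * (η / N) ^ m + -S / (B - S) * (-(η / N)) ^ m) := by
      rw [← neg_div, div_pow, div_pow]
      field_simp
      ring
    rw [hm', hfin] at hdiff
    simp only [if_true, add_zero, Bool.false_eq_true, if_false]
    linarith
  · have e0 : ∀ i : Fin (2 * N + 1) ⊕ Bool,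
        (Sum.elim (fun k : Fin (2 * N + 1) => (|c k| - c k) / (B - S)) (fun _ => 0) i : ℝ) *
        |(Sum.elim (fun k : Fin (2 * N + 1) => (((k : ℕ) : ℝ) - N) / N)
          (fun b : Bool => if b then η / N else -(η / N)) i : ℝ)| =
        Sum.elim (fun k : Fin (2 * N + 1) => (|c k| - c k) / (B - S) * |(((k : ℕ) : ℝ) - N) / N|)
          (fun _ => 0) i := by
      rintro (k | b) <;> simp
    rw [Finset.sum_congr rfl fun i _ => e0 i,
      hsum (fun k => (|c k| - c k) / (B - S) * |((k : ℝ) - N) / N|),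
      ← Finset.add_sum_erase _ _ hNmem]
    have : ∑ k ∈ (Finset.range (2 * N + 1)).erase N, (|c k| - c k) / (B - S) * |((k : ℝ) - N) / N|
        ≤ A := by
      refine Finset.sum_le_sum fun k hk => ?_
      have hk2 : k ≤ 2 * N := by
        have := Finset.mem_range.1 (Finset.mem_of_mem_erase hk); omega
      have h1 : |((k : ℝ) - N) / N| ≤ 1 := by
        rw [abs_div, abs_of_pos hN0, div_le_one hN0, abs_le]
        have : (k : ℝ) ≤ 2 * N := by exact_mod_cast hk2
        have : (0 : ℝ) ≤ (k : ℝ) := by positivity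
        constructor <;> linarith
      have h2 : (|c k| - c k) / (B - S) ≤ |c k| := by
        rw [div_le_iff₀ hD]
        have := neg_abs_le (c k)
        nlinarith [abs_nonneg (c k)]
      calc _ ≤ |c k| * 1 := mul_le_mul h2 h1 (abs_nonneg _) (abs_nonneg _)
        _ = _ := mul_one _
    simp only [sub_self, zero_div, abs_zero, mul_zero, zero_add, add_zero]
    linarith
  · rintro (k | b) h
    · simp only [Sum.elim_inl] at h ⊢
      have hk : (k : ℕ) ≠ N := by
        intro hk
        rw [hk, hcN] at h
        simp at h
      rw [abs_div, abs_of_pos hN0]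
      have h1 : 1 ≤ |((k : ℕ) : ℝ) - N| := by
        have := one_le_sq_sub hk
        rwa [one_le_sq_iff_one_le_abs] at this
      gcongr
      linarith
    · have : η / N ≤ |η / N| := le_abs_self _
      cases b <;> simpa using this

/-! ### Gaussian mixtures with matching moments -/

/-- In the Taylor tail `m ≥ K`, so `|a|^m ≤ (R|a|)^m / R^K`. -/
theorem abs_exp_sub_sum_le (K : ℕ) {R : ℝ} (hR : 1 ≤ R) (a : ℝ) :
    |Real.exp a - ∑ m ∈ Finset.range K, a ^ m / m.factorial| ≤ Real.exp (R * |a|) / R ^ K := by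
  have h1 : |Real.exp a - ∑ m ∈ Finset.range K, a ^ m / m.factorial| ≤
      Real.exp |a| - ∑ m ∈ Finset.range K, |a| ^ m / m.factorial := by
    have := Complex.norm_exp_sub_sum_le_exp_norm_sub_sum (a : ℂ) K
    rw [Complex.norm_real, Real.norm_eq_abs] at this
    rw [← Real.norm_eq_abs, ← Complex.norm_real]
    push_cast
    exact this
  refine h1.trans ?_
  rw [le_div_iff₀ (by positivity), mul_comm]
  have hs : ∀ s : ℝ, HasSum (fun m : ℕ => s ^ m / m.factorial) (Real.exp s) := fun s => by
    rw [Real.exp_eq_exp_ℝ]; exact NormedSpace.expSeries_div_hasSum_exp s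
  have h2 := ((hasSum_nat_add_iff' K).2 (hs |a|)).mul_left (R ^ K)
  have h3 := (hasSum_nat_add_iff' K).2 (hs (R * |a|))
  have h4 := hasSum_le (fun m => ?_) h2 h3
  · have : 0 ≤ ∑ m ∈ Finset.range K, (R * |a|) ^ m / m.factorial :=
      Finset.sum_nonneg fun _ _ => by positivity
    linarith
  · rw [mul_pow, ← mul_div_assoc]
    gcongr
    omega

theorem abs_sum_pow_div_factorial_le (K : ℕ) (a : ℝ) :
    |∑ m ∈ Finset.range K, a ^ m / m.factorial| ≤ Real.exp |a| := by
  refine (Finset.abs_sum_le_sum_abs _ _).trans ?_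
  simp_rw [abs_div, abs_pow, Nat.abs_cast]
  exact Real.sum_le_exp_of_nonneg (abs_nonneg a) K

/-- `exp (x * u - u ^ 2 / 2)` is the likelihood ratio of `N(u, 1)` to `N(0, 1)`. Truncating its two
exponential factors separately gives a polynomial in `u`, with an error uniform over `|u| ≤ 1`. -/
theorem abs_exp_sub_mul_sum_le (K : ℕ) {R : ℝ} (hR : 1 ≤ R) (x : ℝ) {u : ℝ} (hu : |u| ≤ 1) :
    |Real.exp (x * u - u ^ 2 / 2) - (∑ m ∈ Finset.range K, (x * u) ^ m / m.factorial) *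
      ∑ m ∈ Finset.range K, (-(u ^ 2 / 2)) ^ m / m.factorial| ≤
      2 * Real.exp (R * |x| + R) / R ^ K := by
  set A := x * u
  set B := -(u ^ 2 / 2) with hB
  set SA := ∑ m ∈ Finset.range K, A ^ m / m.factorial
  set SB := ∑ m ∈ Finset.range K, B ^ m / m.factorial
  have hu2 : u ^ 2 ≤ 1 := by rwa [sq_le_one_iff_abs_le_one]
  have hA : |A| ≤ |x| := by
    rw [abs_mul]; nlinarith [abs_nonneg x]
  have hBa : |B| ≤ 1 := by
    rw [abs_neg, abs_of_nonneg (by positivity)]; linarith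
  have e : Real.exp (A - u ^ 2 / 2) - SA * SB =
      (Real.exp A - SA) * Real.exp B + SA * (Real.exp B - SB) := by
    rw [show A - u ^ 2 / 2 = A + B by rw [hB]; ring, Real.exp_add]; ring
  rw [e]
  have hR0 : 0 < R := by linarith
  have h1 : |(Real.exp A - SA) * Real.exp B| ≤ Real.exp (R * |x| + R) / R ^ K := by
    rw [abs_mul, Real.abs_exp]
    have hb : Real.exp B ≤ 1 := Real.exp_le_one_iff.2 (by rw [hB]; nlinarith [sq_nonneg u])
    calc _ ≤ Real.exp (R * |A|) / R ^ K * 1 :=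
          mul_le_mul (abs_exp_sub_sum_le K hR A) hb (Real.exp_pos _).le (by positivity)
      _ ≤ _ := by
          rw [mul_one]; gcongr
          nlinarith
  have h2 : |SA * (Real.exp B - SB)| ≤ Real.exp (R * |x| + R) / R ^ K := by
    rw [abs_mul]
    calc _ ≤ Real.exp |A| * (Real.exp (R * |B|) / R ^ K) :=
          mul_le_mul (abs_sum_pow_div_factorial_le K A) (abs_exp_sub_sum_le K hR B) (abs_nonneg _)
            (Real.exp_pos _).le
      _ = Real.exp (|A| + R * |B|) / R ^ K := by rw [Real.exp_add]; ring
      _ ≤ _ := by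
          gcongr
          · nlinarith [abs_nonneg x]
          · nlinarith
  calc _ ≤ _ := abs_add_le _ _
    _ ≤ _ := add_le_add h1 h2
    _ = _ := by ring

/-- The truncated ratio has degree at most `3(K - 1)` in `u`, within the matched range. -/
theorem sum_mul_taylor_eq {ι : Type*} [Fintype ι] {u w₀ w₁ : ι → ℝ} (K : ℕ)
    (hmom : ∀ m ≤ 4 * K, ∑ i, w₀ i * u i ^ m = ∑ i, w₁ i * u i ^ m) (x : ℝ) :
    ∑ i, w₀ i * ((∑ m ∈ Finset.range K, (x * u i) ^ m / m.factorial) *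
      ∑ m ∈ Finset.range K, (-(u i ^ 2 / 2)) ^ m / m.factorial) =
    ∑ i, w₁ i * ((∑ m ∈ Finset.range K, (x * u i) ^ m / m.factorial) *
      ∑ m ∈ Finset.range K, (-(u i ^ 2 / 2)) ^ m / m.factorial) := by
  have key : ∀ w : ι → ℝ, ∑ i, w i * ((∑ m ∈ Finset.range K, (x * u i) ^ m / m.factorial) *
      ∑ m ∈ Finset.range K, (-(u i ^ 2 / 2)) ^ m / m.factorial) =
      ∑ a ∈ Finset.range K, ∑ b ∈ Finset.range K,
        (x ^ a / a.factorial * ((-(1 / 2)) ^ b / b.factorial)) *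
          ∑ i, w i * u i ^ (a + 2 * b) := by
    intro w
    simp_rw [Finset.sum_mul_sum, Finset.mul_sum]
    rw [Finset.sum_comm]
    refine Finset.sum_congr rfl fun a _ => ?_
    rw [Finset.sum_comm]
    refine Finset.sum_congr rfl fun b _ => Finset.sum_congr rfl fun i _ => ?_
    rw [show -(u i ^ 2 / 2) = -(1 / 2) * u i ^ 2 by ring, mul_pow, mul_pow, pow_add, pow_mul]
    ring
  rw [key, key]
  refine Finset.sum_congr rfl fun a ha => Finset.sum_congr rfl fun b hb => ?_
  have := Finset.mem_range.1 ha
  have := Finset.mem_range.1 hb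
  rw [hmom _ (by omega)]

theorem sum_mul_exp_le {ι : Type*} [Fintype ι] {u w₀ w₁ : ι → ℝ} (K : ℕ) {R : ℝ} (hR : 1 ≤ R)
    (h0 : ∀ i, 0 ≤ w₀ i) (h1 : ∀ i, 0 ≤ w₁ i) (hs0 : ∑ i, w₀ i = 1) (hs1 : ∑ i, w₁ i = 1)
    (hu : ∀ i, |u i| ≤ 1)
    (hmom : ∀ m ≤ 4 * K, ∑ i, w₀ i * u i ^ m = ∑ i, w₁ i * u i ^ m) (x : ℝ) :
    ∑ i, w₁ i * Real.exp (x * u i - u i ^ 2 / 2) ≤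
      ∑ i, w₀ i * Real.exp (x * u i - u i ^ 2 / 2) + 4 * Real.exp (R * |x| + R) / R ^ K := by
  set P : ι → ℝ := fun i => (∑ m ∈ Finset.range K, (x * u i) ^ m / m.factorial) *
      ∑ m ∈ Finset.range K, (-(u i ^ 2 / 2)) ^ m / m.factorial with hP
  set D := 2 * Real.exp (R * |x| + R) / R ^ K with hD
  have hb := fun i => abs_le.1 (abs_exp_sub_mul_sum_le K hR x (hu i))
  have e1 : ∑ i, w₁ i * Real.exp (x * u i - u i ^ 2 / 2) ≤ ∑ i, w₁ i * P i + D := by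
    calc _ ≤ ∑ i, w₁ i * (P i + D) := by
          gcongr with i
          · exact h1 i
          · linarith [(hb i).2]
      _ = _ := by simp_rw [mul_add]; rw [Finset.sum_add_distrib, ← Finset.sum_mul, hs1, one_mul]
  have e0 : ∑ i, w₀ i * P i ≤ ∑ i, w₀ i * Real.exp (x * u i - u i ^ 2 / 2) + D := by
    calc _ ≤ ∑ i, w₀ i * (Real.exp (x * u i - u i ^ 2 / 2) + D) := by
          gcongr with i
          · exact h0 i
          · linarith [(hb i).1]
      _ = _ := by simp_rw [mul_add]; rw [Finset.sum_add_distrib, ← Finset.sum_mul, hs0, one_mul]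
  have e : ∑ i, w₀ i * P i = ∑ i, w₁ i * P i := sum_mul_taylor_eq K hmom x
  have : 4 * Real.exp (R * |x| + R) / R ^ K = D + D := by rw [hD]; ring
  linarith

theorem lintegral_gaussianReal_one (u : ℝ) {g : ℝ → ℝ≥0∞} (hg : Measurable g) :
    ∫⁻ x, g x ∂(gaussianReal u 1) =
      ∫⁻ x, ENNReal.ofReal (Real.exp (x * u - u ^ 2 / 2)) * g x ∂(gaussianReal 0 1) := by
  rw [gaussianReal_of_var_ne_zero _ one_ne_zero, gaussianReal_of_var_ne_zero _ one_ne_zero,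
    lintegral_withDensity_eq_lintegral_mul _ (measurable_gaussianPDF _ _) hg,
    lintegral_withDensity_eq_lintegral_mul _ (measurable_gaussianPDF _ _) (by fun_prop)]
  refine lintegral_congr fun x => ?_
  simp only [Pi.mul_apply]
  rw [← mul_assoc]
  congr 1
  rw [gaussianPDF, gaussianPDF, ← ENNReal.ofReal_mul (gaussianPDFReal_nonneg _ _ _)]
  congr 1
  unfold gaussianPDFReal
  rw [mul_assoc (√(2 * Real.pi * ((1 : NNReal) : ℝ)))⁻¹, ← Real.exp_add]
  congr 2
  simp
  ring

theorem lintegral_exp_mul_abs_le (R : ℝ) :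
    ∫⁻ x, ENNReal.ofReal (Real.exp (R * |x|)) ∂(gaussianReal 0 1) ≤
      ENNReal.ofReal (2 * Real.exp (R ^ 2 / 2)) := by
  have h : ∀ u : ℝ, ∫⁻ x, ENNReal.ofReal (Real.exp (x * u)) ∂(gaussianReal 0 1) =
      ENNReal.ofReal (Real.exp (u ^ 2 / 2)) := by
    intro u
    -- Integrating a constant against the likelihood ratio yields the moment generating function.
    have h1 := lintegral_gaussianReal_one u (g := fun _ => ENNReal.ofReal (Real.exp (u ^ 2 / 2)))
      measurable_const
    rw [lintegral_const, measure_univ, mul_one] at h1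
    rw [h1]
    refine lintegral_congr fun x => ?_
    rw [← ENNReal.ofReal_mul (Real.exp_pos _).le, ← Real.exp_add]
    congr 2; ring
  calc _ ≤ ∫⁻ x, ENNReal.ofReal (Real.exp (x * R)) + ENNReal.ofReal (Real.exp (x * (-R)))
        ∂(gaussianReal 0 1) := by
        refine lintegral_mono fun x => ?_
        rcases abs_choice x with hx | hx <;> rw [hx]
        · rw [mul_comm]; exact le_self_add
        · rw [show R * -x = x * -R by ring]; exact le_add_self
    _ = _ := by
        rw [lintegral_add_left (by fun_prop), h, h, neg_sq,
          ← ENNReal.ofReal_add (by positivity) (by positivity)]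
        congr 1; ring

/-- The pointwise density comparison, integrated against `N(0, 1)`. Ranging over all `g` with values
in `[0, 1]`, it is a one-sided total variation bound. -/
theorem sum_mul_lintegral_gaussianReal_one_le {ι : Type*} [Fintype ι] {u w₀ w₁ : ι → ℝ} (K : ℕ)
    {R : ℝ} (hR : 1 ≤ R) (h0 : ∀ i, 0 ≤ w₀ i) (h1 : ∀ i, 0 ≤ w₁ i) (hs0 : ∑ i, w₀ i = 1)
    (hs1 : ∑ i, w₁ i = 1) (hu : ∀ i, |u i| ≤ 1)
    (hmom : ∀ m ≤ 4 * K, ∑ i, w₀ i * u i ^ m = ∑ i, w₁ i * u i ^ m)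
    {g : ℝ → ℝ≥0∞} (hg : Measurable g) (hg1 : ∀ x, g x ≤ 1) :
    ∑ i, ENNReal.ofReal (w₁ i) * ∫⁻ x, g x ∂(gaussianReal (u i) 1) ≤
      ∑ i, ENNReal.ofReal (w₀ i) * ∫⁻ x, g x ∂(gaussianReal (u i) 1) +
        ENNReal.ofReal (8 * Real.exp (R + R ^ 2 / 2) / R ^ K) := by
  have hR0 : 0 < R := by linarith
  have key : ∀ w : ι → ℝ, (∀ i, 0 ≤ w i) →
      ∑ i, ENNReal.ofReal (w i) * ∫⁻ x, g x ∂(gaussianReal (u i) 1) =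
      ∫⁻ x, ENNReal.ofReal (∑ i, w i * Real.exp (x * u i - u i ^ 2 / 2)) * g x
        ∂(gaussianReal 0 1) := by
    intro w hw
    calc _ = ∑ i, ∫⁻ x, ENNReal.ofReal (w i) *
          (ENNReal.ofReal (Real.exp (x * u i - u i ^ 2 / 2)) * g x) ∂(gaussianReal 0 1) := by
          refine Finset.sum_congr rfl fun i _ => ?_
          rw [lintegral_gaussianReal_one _ hg, lintegral_const_mul _ (by fun_prop)]
      _ = _ := by
          rw [← lintegral_finsetSum _ (fun i _ => by fun_prop)]
          refine lintegral_congr fun x => ?_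
          rw [ENNReal.ofReal_sum_of_nonneg fun i _ => mul_nonneg (hw i) (Real.exp_pos _).le,
            Finset.sum_mul]
          refine Finset.sum_congr rfl fun i _ => ?_
          rw [ENNReal.ofReal_mul (hw i), mul_assoc]
  rw [key _ h1, key _ h0]
  calc _ ≤ ∫⁻ x, ENNReal.ofReal (∑ i, w₀ i * Real.exp (x * u i - u i ^ 2 / 2)) * g x +
        ENNReal.ofReal (4 * Real.exp R / R ^ K) * ENNReal.ofReal (Real.exp (R * |x|))
          ∂(gaussianReal 0 1) := by
        refine lintegral_mono fun x => ?_
        have h2 := sum_mul_exp_le K hR h0 h1 hs0 hs1 hu hmom x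
        have h3 : 4 * Real.exp (R * |x| + R) / R ^ K =
            4 * Real.exp R / R ^ K * Real.exp (R * |x|) := by rw [Real.exp_add]; ring
        rw [h3] at h2
        calc _ ≤ (ENNReal.ofReal (∑ i, w₀ i * Real.exp (x * u i - u i ^ 2 / 2)) +
              ENNReal.ofReal (4 * Real.exp R / R ^ K) * ENNReal.ofReal (Real.exp (R * |x|))) *
                g x := by
              gcongr
              rw [← ENNReal.ofReal_mul (by positivity), ← ENNReal.ofReal_add
                (Finset.sum_nonneg fun i _ => mul_nonneg (h0 i) (Real.exp_pos _).le)
                (by positivity)]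
              exact ENNReal.ofReal_le_ofReal h2
          _ ≤ _ := by
              rw [add_mul]
              exact add_le_add le_rfl (mul_le_of_le_one_right' (hg1 x))
    _ = ∫⁻ x, ENNReal.ofReal (∑ i, w₀ i * Real.exp (x * u i - u i ^ 2 / 2)) * g x
          ∂(gaussianReal 0 1) + ENNReal.ofReal (4 * Real.exp R / R ^ K) *
          ∫⁻ x, ENNReal.ofReal (Real.exp (R * |x|)) ∂(gaussianReal 0 1) := by
        rw [lintegral_add_left (by fun_prop), lintegral_const_mul _ (by fun_prop)]
    _ ≤ _ := by
        gcongr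
        calc _ ≤ ENNReal.ofReal (4 * Real.exp R / R ^ K) *
              ENNReal.ofReal (2 * Real.exp (R ^ 2 / 2)) := by
              gcongr; exact lintegral_exp_mul_abs_le R
          _ = _ := by
              rw [← ENNReal.ofReal_mul (by positivity), Real.exp_add]
              congr 1; ring

theorem sum_mul_lintegral_gaussianReal_le {ι : Type*} [Fintype ι] {u w₀ w₁ : ι → ℝ} (K : ℕ)
    {R : ℝ} (hR : 1 ≤ R) (h0 : ∀ i, 0 ≤ w₀ i) (h1 : ∀ i, 0 ≤ w₁ i) (hs0 : ∑ i, w₀ i = 1)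
    (hs1 : ∑ i, w₁ i = 1) (hu : ∀ i, |u i| ≤ 1)
    (hmom : ∀ m ≤ 4 * K, ∑ i, w₀ i * u i ^ m = ∑ i, w₁ i * u i ^ m) (σ : ℝ)
    {g : ℝ → ℝ≥0∞} (hg : Measurable g) (hg1 : ∀ x, g x ≤ 1) :
    ∑ i, ENNReal.ofReal (w₁ i) * ∫⁻ x, g x ∂(gaussianReal (σ * u i) (σ ^ 2).toNNReal) ≤
      ∑ i, ENNReal.ofReal (w₀ i) * ∫⁻ x, g x ∂(gaussianReal (σ * u i) (σ ^ 2).toNNReal) +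
        ENNReal.ofReal (8 * Real.exp (R + R ^ 2 / 2) / R ^ K) := by
  have hm : ∀ i, ∫⁻ x, g x ∂(gaussianReal (σ * u i) (σ ^ 2).toNNReal) =
      ∫⁻ x, g (σ * x) ∂(gaussianReal (u i) 1) := by
    intro i
    have h : gaussianReal (σ * u i) (σ ^ 2).toNNReal = (gaussianReal (u i) 1).map (σ * ·) := by
      rw [gaussianReal_map_const_mul, mul_one]
      congr 1
      ext; simp [sq_nonneg]
    rw [h, lintegral_map hg (by fun_prop)]
  simp_rw [hm]
  exact sum_mul_lintegral_gaussianReal_one_le K hR h0 h1 hs0 hs1 hu hmom (by fun_prop)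
    fun x => hg1 _

/-! ### Tensorisation of the mixture comparison. -/

theorem lintegral_pi_succ {d : ℕ} (μ : Fin (d + 1) → Measure ℝ) [∀ i, IsProbabilityMeasure (μ i)]
    {f : (Fin (d + 1) → ℝ) → ℝ≥0∞} (hf : Measurable f) :
    ∫⁻ x, f x ∂(Measure.pi μ) =
      ∫⁻ a, ∫⁻ y, f (Fin.cons a y) ∂(Measure.pi fun i => μ i.succ) ∂(μ 0) := by
  have h := (measurePreserving_piFinSuccAbove μ 0).symm
  rw [← h.lintegral_comp hf, lintegral_prod _ (by fun_prop)]
  simp [MeasurableEquiv.piFinSuccAbove, Fin.insertNthEquiv]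

theorem measurable_finCons {d : ℕ} :
    Measurable fun p : ℝ × (Fin d → ℝ) => (Fin.cons p.1 p.2 : Fin (d + 1) → ℝ) := by
  refine measurable_pi_lambda _ (Fin.cases ?_ fun i => ?_)
  · simpa using measurable_fst
  · simp only [Fin.cons_succ]; fun_prop

/-- Hybrid argument: with the first coordinate frozen, induction replaces `w` by `w'` in the others
at cost `d * δ`; the averaged function `G w'` still takes values in `[0, 1]`, so replacing `w` in
the first coordinate costs one more `δ`. The laws may vary with `i` so that one coordinate can be
deterministic in mean. -/
theorem sum_prod_mul_lintegral_pi_le {ι : Type*} [Fintype ι] (w w' : ι → ℝ≥0∞)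
    (hw : ∑ k, w k = 1) (hw' : ∑ k, w' k = 1) (δ : ℝ≥0∞) :
    ∀ (d : ℕ) (μ : Fin d → ι → Measure ℝ) [∀ i k, IsProbabilityMeasure (μ i k)],
      (∀ i (g : ℝ → ℝ≥0∞), Measurable g → (∀ x, g x ≤ 1) →
        ∑ k, w k * ∫⁻ x, g x ∂(μ i k) ≤ ∑ k, w' k * ∫⁻ x, g x ∂(μ i k) + δ) →
      ∀ f : (Fin d → ℝ) → ℝ≥0∞, Measurable f → (∀ x, f x ≤ 1) →
        ∑ k : Fin d → ι, (∏ i, w (k i)) * ∫⁻ x, f x ∂(Measure.pi fun i => μ i (k i)) ≤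
          ∑ k : Fin d → ι, (∏ i, w' (k i)) * ∫⁻ x, f x ∂(Measure.pi fun i => μ i (k i)) +
            d * δ := by
  intro d
  induction d with
  | zero =>
    intro μ _ _ f _ _
    simp
  | succ d ih =>
    intro μ _ hμ f hf hf1
    have hfc : Measurable fun p : ℝ × (Fin d → ℝ) => f (Fin.cons p.1 p.2) :=
      hf.comp measurable_finCons
    have hmeas : ∀ k : Fin d → ι, Measurable fun a : ℝ =>
        ∫⁻ y, f (Fin.cons a y) ∂(Measure.pi fun i => μ i.succ (k i)) :=
      fun k => hfc.lintegral_prod_right'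
    set G : (ι → ℝ≥0∞) → ℝ → ℝ≥0∞ := fun v a => ∑ k : Fin d → ι, (∏ i, v (k i)) *
      ∫⁻ y, f (Fin.cons a y) ∂(Measure.pi fun i => μ i.succ (k i)) with hG
    have key : ∀ v : ι → ℝ≥0∞, ∀ v' : ι → ℝ≥0∞, ∑ k₀, v' k₀ * ∫⁻ a, G v a ∂(μ 0 k₀) =
        ∑ k₀, ∑ k : Fin d → ι, v' k₀ * (∏ i, v (k i)) *
          ∫⁻ a, ∫⁻ y, f (Fin.cons a y) ∂(Measure.pi fun i => μ i.succ (k i)) ∂(μ 0 k₀) := by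
      intro v v'
      refine Finset.sum_congr rfl fun k₀ _ => ?_
      rw [hG, lintegral_finsetSum _ (fun k _ => (hmeas k).const_mul _), Finset.mul_sum]
      refine Finset.sum_congr rfl fun k _ => ?_
      rw [lintegral_const_mul _ (hmeas k), mul_assoc]
    have expand : ∀ v : ι → ℝ≥0∞,
        ∑ k : Fin (d + 1) → ι, (∏ i, v (k i)) * ∫⁻ x, f x ∂(Measure.pi fun i => μ i (k i)) =
        ∑ k₀, v k₀ * ∫⁻ a, G v a ∂(μ 0 k₀) := by
      intro v
      rw [key, ← Fintype.sum_prod_type',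
        ← (Fin.consEquiv (fun _ : Fin (d + 1) => ι)).sum_comp]
      refine Finset.sum_congr rfl fun p _ => ?_
      rw [Fin.prod_univ_succ, lintegral_pi_succ _ hf]
      simp [Fin.consEquiv]
    rw [expand, expand]
    have hG1 : ∀ a, G w a ≤ G w' a + d * δ := fun a =>
      ih (fun i => μ i.succ) (fun i => hμ i.succ) (fun y => f (Fin.cons a y))
        (hfc.comp measurable_prodMk_left) (fun y => hf1 _)
    have hGm : Measurable (G w') := Finset.measurable_fun_sum _ fun k _ => (hmeas k).const_mul _
    have hGle : ∀ a, G w' a ≤ 1 := by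
      intro a
      calc G w' a ≤ ∑ k : Fin d → ι, ∏ i, w' (k i) := by
            refine Finset.sum_le_sum fun k _ => ?_
            calc _ ≤ (∏ i, w' (k i)) * 1 := by
                  gcongr
                  calc _ ≤ ∫⁻ _, 1 ∂(Measure.pi fun i => μ i.succ (k i)) :=
                        lintegral_mono fun y => hf1 _
                    _ = 1 := by simp
              _ = _ := mul_one _
        _ = ∏ _i : Fin d, ∑ k, w' k := by rw [Finset.prod_univ_sum]; simp
        _ = 1 := by simp [hw']
    calc _ ≤ ∑ k₀, w k₀ * (∫⁻ a, G w' a ∂(μ 0 k₀) + d * δ) := by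
          gcongr with k₀
          calc _ ≤ ∫⁻ a, (G w' a + d * δ) ∂(μ 0 k₀) := lintegral_mono hG1
            _ = _ := by rw [lintegral_add_right _ measurable_const]; simp
      _ = ∑ k₀, w k₀ * ∫⁻ a, G w' a ∂(μ 0 k₀) + d * δ := by
          simp_rw [mul_add]
          rw [Finset.sum_add_distrib, ← Finset.sum_mul, hw, one_mul]
      _ ≤ _ := by
          grw [hμ 0 (G w') hGm hGle]
          push_cast
          rw [add_mul, one_mul, add_assoc, add_comm δ]

/-! ### The lower bound -/

theorem sum_prod_eq_one {ι κ : Type*} [Fintype ι] [Fintype κ] [DecidableEq κ] {w : ι → ℝ≥0∞}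
    (hw : ∑ j, w j = 1) : ∑ k : κ → ι, ∏ i, w (k i) = 1 := by
  have := Finset.prod_univ_sum (fun _ : κ => (Finset.univ : Finset ι)) (fun _ j => w j)
  simp only [hw, Fintype.piFinset_univ] at this
  rw [← this]; simp

/-- Marginalisation of a product prior to one coordinate. -/
theorem sum_prod_mul_apply {ι κ : Type*} [Fintype ι] [Fintype κ] [DecidableEq κ] {w : ι → ℝ≥0∞}
    (hw : ∑ j, w j = 1) (h : ι → ℝ≥0∞) (i₀ : κ) :
    ∑ k : κ → ι, (∏ i, w (k i)) * h (k i₀) = ∑ j, w j * h j := by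
  have := Finset.prod_univ_sum (fun _ : κ => (Finset.univ : Finset ι))
    (fun i j => w j * if i = i₀ then h j else 1)
  simp only [Fintype.piFinset_univ, Finset.prod_mul_distrib, Finset.prod_ite_eq',
    Finset.mem_univ, if_true] at this
  rw [← this, ← Finset.mul_prod_erase _ _ (Finset.mem_univ i₀)]
  rw [Finset.prod_eq_one fun i hi => by simp [Finset.ne_of_mem_erase hi, hw]]
  simp

instance isProbabilityMeasure_gaussianSeq {d : ℕ} (σ : ℝ) (v : Fin d → ℝ) :
    IsProbabilityMeasure (gaussianSeq σ v) := by
  unfold gaussianSeq; infer_instance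

theorem measure_eq_zero_add_measure_eq_one {d : ℕ} (σ : ℝ) (v : Fin d → ℝ)
    {ψ : (Fin d → ℝ) → Fin 2} (hψ : Measurable ψ) :
    gaussianSeq σ v {x | ψ x = 0} + gaussianSeq σ v {x | ψ x = 1} = 1 := by
  have hm : MeasurableSet {x | ψ x = 0} := hψ (measurableSet_singleton 0)
  have h : {x | ψ x = 1} = {x | ψ x = 0}ᶜ := by
    ext x
    change ψ x = 1 ↔ ¬ ψ x = 0
    generalize ψ x = y
    fin_cases y <;> simp
  rw [h, measure_add_measure_compl hm, measure_univ]

/-- Under the alternative mixture the two error probabilities add to 1. The first is at most `β`.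
The second is at most `α` plus the Markov loss `γ / 4` for null draws of norm above `ε₀`, plus the
mixture error `γ / 4`. The total falls short of 1. -/
theorem testRisk_not_lt_of_matching {ι : Type*} [Fintype ι] {u w₀ w₁ : ι → ℝ} (K : ℕ)
    {R : ℝ} (hR : 1 ≤ R) (h0 : ∀ i, 0 ≤ w₀ i) (h1 : ∀ i, 0 ≤ w₁ i) (hs0 : ∑ i, w₀ i = 1)
    (hs1 : ∑ i, w₁ i = 1) (hu : ∀ i, |u i| ≤ 1)
    (hmom : ∀ m ≤ 4 * K, ∑ i, w₀ i * u i ^ m = ∑ i, w₁ i * u i ^ m)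
    {M L : ℝ} (hM : ∑ i, w₀ i * |u i| ≤ M) (hL : ∀ i, w₁ i ≠ 0 → L ≤ |u i|)
    {n : ℕ} {σ α β γ ε₀ ε₁ r : ℝ} (hσ : 0 < σ) (hα : 0 < α) (hβ : 0 < β) (hγ : 0 < γ)
    (hαβ : α + β + γ = 1) (hr : 0 ≤ r) (hrε : r < ε₀)
    (hMarkov : n * (σ * M) ≤ γ / 4 * (ε₀ - r))
    (hδ : (n + 1) * (8 * Real.exp (R + R ^ 2 / 2) / R ^ K) ≤ γ / 4)
    (hε₁ : ε₁ ≤ r + n * (σ * L)) {ψ : (Fin (n + 1) → ℝ) → Fin 2}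
    (hψ : IsValidTest σ α ε₀ ψ) : ¬ testRisk σ ε₁ ψ < ENNReal.ofReal β := by
  intro hrisk
  obtain ⟨hψm, hψα⟩ := hψ
  have hR0 : 0 < R := by linarith
  set W₀ : ι → ℝ≥0∞ := fun i => ENNReal.ofReal (w₀ i) with hW₀
  set W₁ : ι → ℝ≥0∞ := fun i => ENNReal.ofReal (w₁ i) with hW₁
  have hWs0 : ∑ i, W₀ i = 1 := by
    rw [hW₀, ← ENNReal.ofReal_sum_of_nonneg fun i _ => h0 i, hs0, ENNReal.ofReal_one]
  have hWs1 : ∑ i, W₁ i = 1 := by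
    rw [hW₁, ← ENNReal.ofReal_sum_of_nonneg fun i _ => h1 i, hs1, ENNReal.ofReal_one]
  set δ : ℝ≥0∞ := ENNReal.ofReal (8 * Real.exp (R + R ^ 2 / 2) / R ^ K) with hδdef
  -- Coordinate `0` has mean `r` under both priors, so it costs nothing in the comparison; the other
  -- `n` means are `σ * u k`.
  set c : Fin (n + 1) → ι → ℝ := Fin.cons (fun _ => r) (fun _ k => σ * u k) with hc
  have hc0 : ∀ k, c 0 k = r := fun k => by simp [hc]
  have hcs : ∀ (i : Fin n) k, c i.succ k = σ * u k := fun i k => by simp [hc]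
  have hnorm : ∀ k : Fin (n + 1) → ι, l1norm (fun i => c i (k i)) =
      r + ∑ i : Fin n, σ * |u (k i.succ)| := by
    intro k
    unfold l1norm
    rw [Fin.sum_univ_succ]
    simp_rw [hc0, hcs, abs_mul, abs_of_pos hσ]
    rw [abs_of_nonneg hr]
  have hmeas1 : MeasurableSet {x | ψ x = 1} := hψm (measurableSet_singleton 1)
  have hcmp := sum_prod_mul_lintegral_pi_le W₁ W₀ hWs1 hWs0 δ (n + 1)
    (fun i k => gaussianReal (c i k) (σ ^ 2).toNNReal) (by
      intro i g hg hg1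
      refine Fin.cases ?_ (fun j => ?_) i
      · simp_rw [hc0]
        rw [← Finset.sum_mul, ← Finset.sum_mul, hWs0, hWs1]
        exact le_self_add
      · simp_rw [hcs]
        exact sum_mul_lintegral_gaussianReal_le K hR h0 h1 hs0 hs1 hu hmom σ hg hg1)
    ({x | ψ x = 1}.indicator 1) (measurable_one.indicator hmeas1)
    (fun x => Set.indicator_le_self' (by simp) x)
  simp_rw [lintegral_indicator_one hmeas1] at hcmp
  change ∑ k : Fin (n + 1) → ι, (∏ i, W₁ (k i)) *
      gaussianSeq σ (fun i => c i (k i)) {x | ψ x = 1} ≤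
    ∑ k : Fin (n + 1) → ι, (∏ i, W₀ (k i)) * gaussianSeq σ (fun i => c i (k i)) {x | ψ x = 1} +
      _ at hcmp
  have hII : ∑ k : Fin (n + 1) → ι, (∏ i, W₁ (k i)) *
      gaussianSeq σ (fun i => c i (k i)) {x | ψ x = 0} ≤ ENNReal.ofReal β := by
    calc _ ≤ ∑ k : Fin (n + 1) → ι, (∏ i, W₁ (k i)) * ENNReal.ofReal β := by
          refine Finset.sum_le_sum fun k _ => ?_
          by_cases hk : ∀ i, w₁ (k i) ≠ 0
          · refine mul_le_mul' le_rfl (le_trans ?_ hrisk.le)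
            refine le_iSup₂_of_le (fun i => c i (k i)) ?_ le_rfl
            rw [hnorm]
            refine hε₁.trans ?_
            gcongr
            calc (n : ℝ) * (σ * L) = ∑ _i : Fin n, σ * L := by simp
              _ ≤ _ := Finset.sum_le_sum fun i _ => by gcongr; exact hL _ (hk _)
          · push Not at hk
            obtain ⟨i, hi⟩ := hk
            rw [Finset.prod_eq_zero (Finset.mem_univ i) (by simp [hW₁, hi])]
            simp
      _ = _ := by rw [← Finset.sum_mul, sum_prod_eq_one hWs1, one_mul]
  have hs : 0 < ε₀ - r := by linarith
  have hI : ∑ k : Fin (n + 1) → ι, (∏ i, W₀ (k i)) *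
      gaussianSeq σ (fun i => c i (k i)) {x | ψ x = 1} ≤
        ENNReal.ofReal α + ENNReal.ofReal (γ / 4) := by
    calc _ ≤ ∑ k : Fin (n + 1) → ι, (∏ i, W₀ (k i)) * (ENNReal.ofReal α +
          ∑ i : Fin n, ENNReal.ofReal (σ * |u (k i.succ)| / (ε₀ - r))) := by
          refine Finset.sum_le_sum fun k _ => mul_le_mul' le_rfl ?_
          by_cases hk : l1norm (fun i => c i (k i)) ≤ ε₀
          · exact (hψα _ hk).trans le_self_add
          · refine prob_le_one.trans (le_trans ?_ le_add_self)
            rw [hnorm, not_le] at hk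
            rw [← ENNReal.ofReal_sum_of_nonneg (fun i _ => by positivity), ← Finset.sum_div,
              ← ENNReal.ofReal_one]
            refine ENNReal.ofReal_le_ofReal ?_
            rw [le_div_iff₀ hs]
            linarith
      _ = ENNReal.ofReal α + ∑ i : Fin n, ∑ k : Fin (n + 1) → ι, (∏ i, W₀ (k i)) *
            ENNReal.ofReal (σ * |u (k i.succ)| / (ε₀ - r)) := by
          simp_rw [mul_add, Finset.mul_sum]
          rw [Finset.sum_add_distrib, ← Finset.sum_mul, sum_prod_eq_one hWs0, one_mul,
            Finset.sum_comm]
      _ = ENNReal.ofReal α + n * ENNReal.ofReal (σ * (∑ j, w₀ j * |u j|) / (ε₀ - r)) := by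
          congr 1
          rw [Finset.sum_congr rfl fun i _ => sum_prod_mul_apply hWs0
            (fun j => ENNReal.ofReal (σ * |u j| / (ε₀ - r))) (Fin.succ i)]
          rw [Finset.sum_const, Finset.card_univ, Fintype.card_fin, nsmul_eq_mul,
            Finset.mul_sum Finset.univ (fun j => w₀ j * |u j|) σ, Finset.sum_div,
            ENNReal.ofReal_sum_of_nonneg fun j _ =>
              div_nonneg (mul_nonneg hσ.le (mul_nonneg (h0 j) (abs_nonneg _))) hs.le]
          congr 1
          refine Finset.sum_congr rfl fun j _ => ?_
          rw [hW₀, ← ENNReal.ofReal_mul (h0 j)]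
          congr 1; ring
      _ ≤ _ := by
          gcongr
          rw [← ENNReal.ofReal_natCast, ← ENNReal.ofReal_mul (by positivity)]
          refine ENNReal.ofReal_le_ofReal ?_
          rw [← mul_div_assoc, div_le_iff₀ hs]
          refine le_trans ?_ hMarkov
          gcongr
  have hone : (1 : ℝ≥0∞) = ∑ k : Fin (n + 1) → ι, (∏ i, W₁ (k i)) *
      gaussianSeq σ (fun i => c i (k i)) {x | ψ x = 0} +
      ∑ k : Fin (n + 1) → ι, (∏ i, W₁ (k i)) *
      gaussianSeq σ (fun i => c i (k i)) {x | ψ x = 1} := by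
    rw [← Finset.sum_add_distrib]
    simp_rw [← mul_add, measure_eq_zero_add_measure_eq_one σ _ hψm, mul_one]
    exact (sum_prod_eq_one hWs1).symm
  have hδ' : ((n + 1 : ℕ) : ℝ≥0∞) * δ ≤ ENNReal.ofReal (γ / 4) := by
    rw [hδdef, ← ENNReal.ofReal_natCast, ← ENNReal.ofReal_mul (by positivity)]
    refine ENNReal.ofReal_le_ofReal ?_
    push_cast; exact hδ
  have hfin : (1 : ℝ≥0∞) ≤ ENNReal.ofReal (β + (α + γ / 4 + γ / 4)) := by
    rw [ENNReal.ofReal_add (by positivity) (by positivity),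
      ENNReal.ofReal_add (by positivity) (by positivity),
      ENNReal.ofReal_add (by positivity) (by positivity), hone]
    exact add_le_add hII (hcmp.trans (add_le_add hI hδ'))
  rw [ENNReal.one_le_ofReal] at hfin
  linarith

theorem exists_sqrt_le_mul_sub {α β b : ℝ} (hα : 0 < α) (hβ : 0 < β) (hαβ : α + β < 1)
    (hb : 0 < b) : ∃ C : ℝ, 0 < C ∧ ∀ d : ℕ, 2 ≤ d → ∀ σ : ℝ, 0 < σ → ∀ ε₀ : ℝ, 0 < ε₀ →
      ε₀ ≤ b * (σ * d) → ∀ ε₁ : ℝ, ε₀ ≤ ε₁ → minimaxRisk d σ α ε₀ ε₁ < ENNReal.ofReal β →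
        √(ε₀ * (σ * d)) ≤ C * Real.log d ^ 3 * (ε₁ - ε₀) := by
  obtain ⟨γ, hγ⟩ : ∃ γ, γ = 1 - α - β := ⟨_, rfl⟩
  have hγ0 : 0 < γ := by linarith
  have hγ1 : γ ≤ 1 := by linarith
  obtain ⟨R, hR⟩ : ∃ R : ℝ, R = Real.exp 1 := ⟨_, rfl⟩
  have hR1 : 1 ≤ R := hR ▸ Real.one_le_exp zero_le_one
  obtain ⟨D, hD⟩ : ∃ D : ℝ, D = 8 * Real.exp (R + R ^ 2 / 2) := ⟨_, rfl⟩
  have hD0 : 0 < D := by rw [hD]; positivity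
  obtain ⟨K₀, hK₀⟩ := exists_nat_ge (4 * D / γ)
  have hb0 : 0 ≤ √b := Real.sqrt_nonneg b
  -- The bound on `θ` gives `s ≤ ε₀`; the one on `θ * √b` gives `4 * N * η ^ 2 ≤ 1` and keeps `s`
  -- below a quarter of `θ * y / N ^ 3`.
  obtain ⟨θ, hθ0, hθγ, hθbγ⟩ : ∃ θ : ℝ, 0 < θ ∧ 64 * θ ≤ γ ∧ 64 * (θ * √b) ≤ γ := by
    refine ⟨γ / (64 * (1 + √b)), by positivity, ?_, ?_⟩
    · rw [← mul_div_assoc, div_le_iff₀ (by positivity)]; nlinarith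
    · rw [div_mul_eq_mul_div, ← mul_div_assoc, div_le_iff₀ (by positivity)]; nlinarith
  obtain ⟨c, hc⟩ : ∃ c : ℝ, c = 2 * (3 + 2 * K₀) := ⟨_, rfl⟩
  have hc0 : 0 < c := by rw [hc]; positivity
  refine ⟨4 * c ^ 3 / θ, by positivity, ?_⟩
  intro d hd σ hσ ε₀ hε₀ hε₀b ε₁ hε₁ hrisk
  have hd2 : (2 : ℝ) ≤ d := by exact_mod_cast hd
  have hd0 : (0 : ℝ) < d := by linarith
  have hσd : 0 < σ * d := by positivity
  obtain ⟨ℓ, hℓ⟩ : ∃ ℓ : ℝ, ℓ = Real.log d := ⟨_, rfl⟩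
  rw [← hℓ]
  have hℓ2 : 1 / 2 ≤ ℓ := by
    have h1 := Real.log_two_gt_d9
    have h2 : Real.log 2 ≤ ℓ := hℓ ▸ Real.log_le_log (by norm_num) hd2
    linarith
  obtain ⟨K, hK⟩ : ∃ K : ℕ, K = ⌈ℓ⌉₊ + K₀ := ⟨_, rfl⟩
  have hKl : ℓ + K₀ ≤ K := by
    rw [hK]; push_cast; linarith [Nat.le_ceil ℓ]
  have hKu : K ≤ ℓ + 1 + K₀ := by
    rw [hK]; push_cast; linarith [(Nat.ceil_lt_add_one (by linarith : (0 : ℝ) ≤ ℓ)).le]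
  have hK1 : 1 ≤ K := by
    have : 0 < ⌈ℓ⌉₊ := Nat.ceil_pos.2 (by linarith)
    omega
  obtain ⟨N, hN⟩ : ∃ N, N = 2 * K := ⟨_, rfl⟩
  have hN1 : 1 ≤ N := by omega
  have hN1' : (1 : ℝ) ≤ N := by exact_mod_cast hN1
  have hNc : N ≤ c * ℓ := by
    rw [hN, hc]; push_cast
    have : (1 + K₀) * (1 / 2 : ℝ) ≤ (1 + K₀) * ℓ := by gcongr
    linarith
  obtain ⟨y, hy⟩ : ∃ y : ℝ, y = √(ε₀ * (σ * d)) := ⟨_, rfl⟩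
  rw [← hy]
  have hy0 : 0 < y := hy ▸ Real.sqrt_pos.2 (by positivity)
  have hy2 : y ^ 2 = ε₀ * (σ * d) := by rw [hy, Real.sq_sqrt (by positivity)]
  have hyb : y ≤ √b * (σ * d) := by
    rw [hy, Real.sqrt_le_left (by positivity), mul_pow, Real.sq_sqrt hb.le]
    calc ε₀ * (σ * d) ≤ b * (σ * d) * (σ * d) := by gcongr
      _ = _ := by ring
  obtain ⟨η, hη⟩ : ∃ η : ℝ, η = θ * y / (σ * d * N ^ 2) := ⟨_, rfl⟩
  have hη0 : 0 < η := by rw [hη]; positivity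
  have hs : 16 * θ ^ 2 * ε₀ / (γ * N ^ 3) = 16 * (σ * d) * N * η ^ 2 / γ := by
    rw [hη, div_pow, mul_pow θ y, hy2]
    field_simp
  have hN3 : (1 : ℝ) ≤ N ^ 3 := one_le_pow₀ hN1'
  have hNη : 4 * N * η ^ 2 ≤ 1 := by
    have h1 : θ * y / (σ * d) ≤ 1 / 64 := by
      rw [div_le_iff₀ hσd]
      have : θ * y ≤ θ * √b * (σ * d) := by rw [mul_assoc]; gcongr
      have : θ * √b * (σ * d) ≤ 1 / 64 * (σ * d) := by gcongr; linarith
      linarith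
    have h2 : 0 ≤ θ * y / (σ * d) := by positivity
    have h3 : 4 * N * η ^ 2 = 4 * (θ * y / (σ * d)) ^ 2 / N ^ 3 := by
      rw [hη]; field_simp
    rw [h3, div_le_one (by positivity)]
    have : (θ * y / (σ * d)) ^ 2 ≤ (1 / 64) ^ 2 := by gcongr
    linarith
  obtain ⟨u, w₀, w₁, h0, h1, hs0, hs1, hu, hmom, hM, hL⟩ := exists_moment_matching N hN1 η hη0 hNη
  obtain ⟨n, rfl⟩ : ∃ n, d = n + 1 := ⟨d - 1, by omega⟩
  have hn : ((n + 1 : ℕ) : ℝ) = n + 1 := by push_cast; ring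
  -- `s` is `4 / γ` times the bound `d * σ * (4 * N * η ^ 2)` on the random part of the null norm,
  -- as Markov's inequality at level `γ / 4` demands.
  obtain ⟨s, hsdef⟩ : ∃ s : ℝ, s = 16 * θ ^ 2 * ε₀ / (γ * N ^ 3) := ⟨_, rfl⟩
  rw [← hsdef] at hs
  have hs_pos : 0 < s := by rw [hsdef]; positivity
  have hsε : s ≤ ε₀ := by
    rw [hsdef, div_le_iff₀ (by positivity)]
    have : 16 * θ ^ 2 ≤ γ := by
      have : θ * θ ≤ θ * 1 := by gcongr; linarith
      linarith [sq θ]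
    calc 16 * θ ^ 2 * ε₀ ≤ γ * ε₀ * 1 := by rw [mul_one]; gcongr
      _ ≤ γ * ε₀ * N ^ 3 := by gcongr
      _ = _ := by ring
  by_contra hcon
  push Not at hcon
  have hgap : ε₁ - ε₀ ≤ θ * y / (4 * N ^ 3) := by
    rw [le_div_iff₀ (by positivity)]
    have h1 : (4 * (N : ℝ) ^ 3) ≤ 4 * (c * ℓ) ^ 3 := by gcongr
    have h2 : θ * (4 * c ^ 3 / θ * ℓ ^ 3 * (ε₁ - ε₀)) ≤ θ * y := by gcongr
    have h3 : θ * (4 * c ^ 3 / θ * ℓ ^ 3 * (ε₁ - ε₀)) = (ε₁ - ε₀) * (4 * (c * ℓ) ^ 3) := by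
      field_simp
    have h4 : (ε₁ - ε₀) * (4 * (N : ℝ) ^ 3) ≤ (ε₁ - ε₀) * (4 * (c * ℓ) ^ 3) :=
      mul_le_mul_of_nonneg_left h1 (by linarith)
    linarith
  have hq : s ≤ θ * y / (4 * N ^ 3) := by
    rw [hsdef, div_le_div_iff₀ (by positivity) (by positivity)]
    have h1 : ε₀ ≤ y * √b := by
      have : ε₀ * (σ * ↑(n + 1)) ≤ (y * √b) * (σ * ↑(n + 1)) := by
        rw [← hy2, sq, mul_assoc]; gcongr
      exact le_of_mul_le_mul_right this hσd
    have h2 : 64 * (θ * ε₀) ≤ γ * y := by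
      calc 64 * (θ * ε₀) ≤ 64 * (θ * (y * √b)) := by gcongr
        _ = (64 * (θ * √b)) * y := by ring
        _ ≤ _ := by gcongr
    calc 16 * θ ^ 2 * ε₀ * (4 * N ^ 3) = 64 * (θ * ε₀) * (θ * N ^ 3) := by ring
      _ ≤ γ * y * (θ * N ^ 3) := by gcongr
      _ = _ := by ring
  have hL' : σ * (η / N) * (n + 1) = θ * y / N ^ 3 := by
    rw [hη, hn]; field_simp
  unfold minimaxRisk at hrisk
  simp only [iInf_lt_iff] at hrisk
  obtain ⟨ψ, hψ, hψrisk⟩ := hrisk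
  refine testRisk_not_lt_of_matching K hR1 h0 h1 hs0 hs1 hu (fun m hm => hmom m (by omega)) hM hL
    (n := n) (γ := γ) (r := ε₀ - s) hσ hα hβ hγ0 (by linarith) (by linarith) (by linarith) ?_ ?_
    ?_ hψ hψrisk
  · rw [sub_sub_cancel, hs]
    calc (n : ℝ) * (σ * (4 * N * η ^ 2)) ≤ ((n + 1 : ℕ) : ℝ) * (σ * (4 * N * η ^ 2)) := by
          gcongr; linarith
      _ = _ := by field_simp; ring
  · rw [← hn, ← hD, ← mul_div_assoc, div_le_iff₀ (by positivity)]
    have hexp : ((n + 1 : ℕ) : ℝ) * (4 * D / γ) ≤ R ^ K := by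
      calc ((n + 1 : ℕ) : ℝ) * (4 * D / γ) ≤ Real.exp ℓ * Real.exp K₀ := by
            rw [hℓ, Real.exp_log hd0]
            gcongr
            linarith [Real.add_one_le_exp (K₀ : ℝ)]
        _ = Real.exp (ℓ + K₀) := (Real.exp_add _ _).symm
        _ ≤ Real.exp K := Real.exp_le_exp.2 hKl
        _ = R ^ K := by rw [hR, ← Real.exp_nat_mul, mul_one]
    calc ((n + 1 : ℕ) : ℝ) * D = γ / 4 * (((n + 1 : ℕ) : ℝ) * (4 * D / γ)) := by
          field_simp
      _ ≤ _ := by gcongr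
  -- Giving up one coordinate costs at most half, since `n + 1 ≤ 2 * n`. The remaining `θ * y / (2 *
  -- N ^ 3)` pays for both `s` and the gap `ε₁ - ε₀`.
  · have hz : 0 < θ * y / N ^ 3 := by positivity
    have h4 : θ * y / (4 * N ^ 3) = θ * y / N ^ 3 / 4 := by field_simp
    have h5 : σ * (η / N) * (n + 1) ≤ σ * (η / N) * (2 * n) := by
      have : (0 : ℝ) < σ * (η / N) := by positivity
      have : (1 : ℝ) ≤ n := by rw [hn] at hd2; linarith
      gcongr; linarith
    rw [h4] at hgap hq
    linarith

/-! ### The plug-in statistic -/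

theorem memLp_abs_gaussianReal (u : ℝ) (v : NNReal) :
    MemLp (fun x : ℝ => |x|) 2 (gaussianReal u v) :=
  (memLp_id_gaussianReal 2).abs

theorem integrable_abs_gaussianReal (u : ℝ) (v : NNReal) :
    Integrable (fun x : ℝ => |x|) (gaussianReal u v) :=
  (memLp_abs_gaussianReal u v).integrable (by norm_num)

/-- Taking absolute values keeps the second moment and can only increase the square of the mean. -/
theorem variance_abs_gaussianReal_le (u : ℝ) (v : NNReal) :
    Var[fun x : ℝ => |x|; gaussianReal u v] ≤ v := by
  have h1 := variance_fun_id_gaussianReal (μ := u) (v := v)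
  have hid : MemLp (fun x : ℝ => x) 2 (gaussianReal u v) := memLp_id_gaussianReal 2
  rw [variance_eq_sub hid] at h1
  rw [variance_eq_sub (memLp_abs_gaussianReal u v)]
  have h2 : |∫ x, x ∂(gaussianReal u v)| ≤ ∫ x, |x| ∂(gaussianReal u v) :=
    abs_integral_le_integral_abs
  have h3 : (∫ x, x ∂(gaussianReal u v)) ^ 2 ≤ (∫ x, |x| ∂(gaussianReal u v)) ^ 2 :=
    sq_le_sq.2 (h2.trans (le_abs_self _))
  simp only [Pi.pow_apply, sq_abs] at h1 ⊢
  linarith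

theorem integral_abs_gaussianReal_eq (u : ℝ) (v : NNReal) :
    ∫ x, |x| ∂(gaussianReal u v) = ∫ x, |x + u| ∂(gaussianReal 0 v) := by
  have h := gaussianReal_map_add_const (μ := 0) (v := v) u
  rw [zero_add] at h
  rw [← h, integral_map (by fun_prop) (by fun_prop)]

theorem integral_abs_gaussianReal_neg (u : ℝ) (v : NNReal) :
    ∫ x, |x| ∂(gaussianReal (-u) v) = ∫ x, |x| ∂(gaussianReal u v) := by
  rw [← gaussianReal_map_neg, integral_map (by fun_prop) (by fun_prop)]
  simp_rw [abs_neg]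

theorem integrable_abs_add_gaussianReal (u : ℝ) (v : NNReal) :
    Integrable (fun x : ℝ => |x + u|) (gaussianReal 0 v) := by
  have h : Integrable (fun x : ℝ => x) (gaussianReal 0 v) :=
    (memLp_id_gaussianReal 1).integrable (by norm_num)
  exact (h.add (integrable_const u)).abs

theorem integral_abs_gaussianReal_sub_le (u : ℝ) (v : NNReal) :
    ∫ x, |x| ∂(gaussianReal u v) - ∫ x, |x| ∂(gaussianReal 0 v) ≤ |u| := by
  rw [integral_abs_gaussianReal_eq]
  have : ∫ x, |x + u| ∂(gaussianReal 0 v) ≤ ∫ x, (|x| + |u|) ∂(gaussianReal 0 v) :=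
    integral_mono (integrable_abs_add_gaussianReal u v)
      ((integrable_abs_gaussianReal 0 v).add (integrable_const _)) fun x => abs_add_le _ _
  rw [integral_add (integrable_abs_gaussianReal 0 v) (integrable_const _)] at this
  simp only [integral_const, probReal_univ, one_smul] at this
  linarith

/-- By symmetry, average over `u` and `-u`: `|x + u| + |x - u|` is at least `2|x|` always, and at
least `2|x| + |u|` when `|x| ≤ |u| / 2`. -/
theorem half_mul_measureReal_le_integral_abs_sub (u : ℝ) (v : NNReal) :
    |u| / 2 * (gaussianReal 0 v).real {x | |x| ≤ |u| / 2} ≤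
      ∫ x, |x| ∂(gaussianReal u v) - ∫ x, |x| ∂(gaussianReal 0 v) := by
  have h1 := integral_abs_gaussianReal_eq u v
  have h2 := integral_abs_gaussianReal_eq (-u) v
  rw [integral_abs_gaussianReal_neg] at h2
  have hm : MeasurableSet {x : ℝ | |x| ≤ |u| / 2} := measurableSet_le (by fun_prop) (by fun_prop)
  have h3 :
      ∫ x, (2 * |x| + {x : ℝ | |x| ≤ |u| / 2}.indicator (fun _ => |u|) x) ∂(gaussianReal 0 v) ≤
      ∫ x, (|x + u| + |x + -u|) ∂(gaussianReal 0 v) := by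
    refine integral_mono (((integrable_abs_gaussianReal 0 v).const_mul 2).add
      ((integrable_const _).indicator hm))
      ((integrable_abs_add_gaussianReal u v).add (integrable_abs_add_gaussianReal (-u) v)) ?_
    intro x
    simp only
    by_cases hx : x ∈ {x : ℝ | |x| ≤ |u| / 2}
    · rw [Set.indicator_of_mem hx]
      have hx' : |x| ≤ |u| / 2 := hx
      have : |2 * u| ≤ |x + u| + |x + -u| := by
        rw [show 2 * u = (x + u) - (x + -u) by ring]; exact abs_sub _ _
      rw [abs_mul, abs_two] at this
      linarith
    · rw [Set.indicator_of_notMem hx, add_zero]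
      have : |2 * x| ≤ |x + u| + |x + -u| := by
        rw [show 2 * x = (x + u) + (x + -u) by ring]; exact abs_add_le _ _
      rw [abs_mul, abs_two] at this
      linarith
  rw [integral_add ((integrable_abs_gaussianReal 0 v).const_mul 2)
      ((integrable_const _).indicator hm), integral_indicator_const _ hm,
    integral_add (integrable_abs_add_gaussianReal u v) (integrable_abs_add_gaussianReal (-u) v),
    ← h1, ← h2, integral_const_mul, smul_eq_mul] at h3
  linarith

theorem exists_mul_le_gaussianReal_abs_le : ∃ c : ℝ, 0 < c ∧ c ≤ 1 ∧ ∀ s : ℝ, 0 ≤ s → s ≤ 1 →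
    c * s ≤ (gaussianReal 0 1).real {x | |x| ≤ s} := by
  -- The density at 1 is its minimum over `[-1, 1]`.
  refine ⟨gaussianPDFReal 0 1 1, gaussianPDFReal_pos _ _ _ one_ne_zero, ?_, fun s hs hs1 => ?_⟩
  · unfold gaussianPDFReal
    refine mul_le_one₀ (inv_le_one_of_one_le₀ ?_) (Real.exp_pos _).le (Real.exp_le_one_iff.2 ?_)
    · rw [Real.one_le_sqrt]
      have := Real.pi_gt_three
      push_cast; linarith
    · norm_num
  have hset : {x : ℝ | |x| ≤ s} = Set.Icc (-s) s := by ext x; exact (abs_le : |x| ≤ s ↔ _)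
  rw [hset, measureReal_def, ← ENNReal.ofReal_le_iff_le_toReal (measure_ne_top _ _),
    gaussianReal_apply _ one_ne_zero]
  calc ENNReal.ofReal (gaussianPDFReal 0 1 1 * s)
      ≤ ENNReal.ofReal (gaussianPDFReal 0 1 1) * ENNReal.ofReal (s - -s) := by
        rw [← ENNReal.ofReal_mul (gaussianPDFReal_nonneg _ _ _)]
        refine ENNReal.ofReal_le_ofReal ?_
        gcongr
        · exact gaussianPDFReal_nonneg _ _ _
        · linarith
    _ = ∫⁻ _ in Set.Icc (-s) s, ENNReal.ofReal (gaussianPDFReal 0 1 1) := by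
        rw [setLIntegral_const, Real.volume_Icc]
    _ ≤ _ := by
        refine setLIntegral_mono (measurable_gaussianPDF _ _) fun x hx => ?_
        refine ENNReal.ofReal_le_ofReal ?_
        unfold gaussianPDFReal
        have : x ^ 2 ≤ 1 := (sq_le_one_iff_abs_le_one x).2 ((abs_le.2 hx).trans hs1)
        have : -(1 - 0 : ℝ) ^ 2 ≤ -(x - 0) ^ 2 := by rw [sub_zero, sub_zero]; linarith
        gcongr

/-- For `|u| ≤ σ` the bias is of order at least `u²/σ`, beyond that of order at least `|u|`. Both
dominate these affine functions of `|u|`, which, unlike the minimum, sum over coordinates to a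
function of the `ℓ₁` norm. -/
theorem exists_mul_le_integral_abs_sub : ∃ c : ℝ, 0 < c ∧ ∀ σ : ℝ, 0 < σ → ∀ u l : ℝ, 0 ≤ l →
    l ≤ 1 → c * (l * |u| - l ^ 2 * σ) ≤ ∫ x, |x| ∂(gaussianReal u (σ ^ 2).toNNReal) -
      ∫ x, |x| ∂(gaussianReal 0 (σ ^ 2).toNNReal) := by
  obtain ⟨c, hc, hc1, H⟩ := exists_mul_le_gaussianReal_abs_le
  refine ⟨c / 4, by positivity, fun σ hσ u l hl hl1 => ?_⟩
  refine le_trans ?_ (half_mul_measureReal_le_integral_abs_sub u _)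
  have hscale : (gaussianReal 0 (σ ^ 2).toNNReal).real {x | |x| ≤ |u| / 2} =
      (gaussianReal 0 1).real {x | |x| ≤ |u| / (2 * σ)} := by
    have h : gaussianReal 0 (σ ^ 2).toNNReal = (gaussianReal 0 1).map (σ * ·) := by
      rw [gaussianReal_map_const_mul, mul_one, mul_zero]
      congr 1
      ext; simp [sq_nonneg]
    rw [h, map_measureReal_apply (by fun_prop) (measurableSet_le (by fun_prop) (by fun_prop))]
    congr 1
    ext x
    change |σ * x| ≤ |u| / 2 ↔ |x| ≤ |u| / (2 * σ)
    rw [abs_mul, abs_of_pos hσ, le_div_iff₀ (by positivity), le_div_iff₀ (by positivity)]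
    constructor <;> intro <;> linarith
  rw [hscale]
  have hu := abs_nonneg u
  rcases le_total |u| σ with h | h
  · have h1 : |u| / (2 * σ) ≤ 1 := by rw [div_le_one (by positivity)]; linarith
    have h2 := H (|u| / (2 * σ)) (by positivity) h1
    have h3 : l * |u| - l ^ 2 * σ ≤ |u| ^ 2 / σ := by
      rw [le_div_iff₀ hσ]
      nlinarith [sq_nonneg (|u| - l * σ), mul_nonneg (mul_nonneg hl hu) hσ.le]
    calc c / 4 * (l * |u| - l ^ 2 * σ) ≤ c / 4 * (|u| ^ 2 / σ) := by gcongr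
      _ = |u| / 2 * (c * (|u| / (2 * σ))) := by field_simp; ring
      _ ≤ _ := by gcongr
  · have h2 := H (1 / 2) (by norm_num) (by norm_num)
    have h3 : (gaussianReal 0 1).real {x | |x| ≤ 1 / 2} ≤
        (gaussianReal 0 1).real {x | |x| ≤ |u| / (2 * σ)} := by
      refine measureReal_mono fun x hx => le_trans (show |x| ≤ 1 / 2 from hx) ?_
      rw [div_le_div_iff₀ (by norm_num) (by positivity)]; linarith
    have h4 : l * |u| - l ^ 2 * σ ≤ |u| := by
      have : 0 ≤ l ^ 2 * σ := by positivity
      have : l * |u| ≤ 1 * |u| := by gcongr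
      linarith
    calc c / 4 * (l * |u| - l ^ 2 * σ) ≤ c / 4 * |u| := by gcongr
      _ = |u| / 2 * (c * (1 / 2)) := by ring
      _ ≤ _ := by gcongr; exact h2.trans h3

theorem measurable_l1norm {d : ℕ} : Measurable (l1norm : (Fin d → ℝ) → ℝ) := by
  unfold l1norm; fun_prop

theorem measurable_plugInStat {d : ℕ} (σ : ℝ) : Measurable (plugInStat σ : (Fin d → ℝ) → ℝ) :=
  measurable_l1norm.sub_const _

theorem integral_l1norm {d : ℕ} (σ : ℝ) (v : Fin d → ℝ) :
    ∫ x, l1norm x ∂(gaussianSeq σ v) = ∑ i, ∫ x, |x| ∂(gaussianReal (v i) (σ ^ 2).toNNReal) := by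
  unfold l1norm gaussianSeq
  rw [integral_finsetSum _ fun i _ => integrable_comp_eval (integrable_abs_gaussianReal _ _)]
  refine Finset.sum_congr rfl fun i _ => ?_
  exact integral_comp_eval (μ := fun i => gaussianReal (v i) (σ ^ 2).toNNReal) (f := fun x => |x|)
    (by fun_prop)

theorem memLp_l1norm {d : ℕ} (σ : ℝ) (v : Fin d → ℝ) : MemLp l1norm 2 (gaussianSeq σ v) := by
  unfold l1norm gaussianSeq
  exact memLp_finsetSum _ fun i _ => (memLp_abs_gaussianReal _ _).comp_measurePreserving
    (measurePreserving_eval (fun i => gaussianReal (v i) (σ ^ 2).toNNReal) i)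

theorem memLp_plugInStat {d : ℕ} (σ : ℝ) (v : Fin d → ℝ) :
    MemLp (plugInStat σ) 2 (gaussianSeq σ v) :=
  (memLp_l1norm σ v).sub (memLp_const _)

theorem integral_plugInStat {d : ℕ} (σ : ℝ) (v : Fin d → ℝ) :
    ∫ x, plugInStat σ x ∂(gaussianSeq σ v) =
      ∑ i, (∫ x, |x| ∂(gaussianReal (v i) (σ ^ 2).toNNReal) -
        ∫ x, |x| ∂(gaussianReal 0 (σ ^ 2).toNNReal)) := by
  unfold plugInStat
  rw [integral_sub ((memLp_l1norm σ v).integrable (by norm_num)) (integrable_const _),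
    integral_const, probReal_univ, one_smul, integral_l1norm, integral_l1norm,
    ← Finset.sum_sub_distrib]
  rfl

theorem integral_plugInStat_le {d : ℕ} (σ : ℝ) (v : Fin d → ℝ) :
    ∫ x, plugInStat σ x ∂(gaussianSeq σ v) ≤ l1norm v := by
  rw [integral_plugInStat]
  exact Finset.sum_le_sum fun i _ => integral_abs_gaussianReal_sub_le _ _

theorem variance_plugInStat_le {d : ℕ} (σ : ℝ) (v : Fin d → ℝ) :
    Var[plugInStat σ; gaussianSeq σ v] ≤ d * σ ^ 2 := by
  unfold plugInStat
  rw [variance_sub_const (memLp_l1norm σ v).aestronglyMeasurable]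
  have h := variance_sum_pi (μ := fun i => gaussianReal (v i) (σ ^ 2).toNNReal)
    (X := fun _ x => |x|) fun i => memLp_abs_gaussianReal _ _
  have e : (l1norm : (Fin d → ℝ) → ℝ) = ∑ i, fun ω => |ω i| := by
    ext x; simp [l1norm]
  rw [e]
  unfold gaussianSeq
  rw [h]
  calc _ ≤ ∑ _i : Fin d, σ ^ 2 := Finset.sum_le_sum fun i _ => by
        refine (variance_abs_gaussianReal_le _ _).trans (le_of_eq ?_)
        exact Real.coe_toNNReal _ (sq_nonneg _)
    _ = _ := by simp

theorem gaussianSeq_abs_sub_integral_ge_le {d : ℕ} (σ : ℝ) (v : Fin d → ℝ) {τ c : ℝ}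
    (hc : 0 < c) (h : d * σ ^ 2 ≤ τ * c ^ 2) :
    gaussianSeq σ v {x | c ≤ |plugInStat σ x - ∫ y, plugInStat σ y ∂(gaussianSeq σ v)|} ≤
      ENNReal.ofReal τ := by
  refine (meas_ge_le_variance_div_sq (memLp_plugInStat σ v) hc).trans (ENNReal.ofReal_le_ofReal ?_)
  rw [div_le_iff₀ (by positivity)]
  exact (variance_plugInStat_le σ v).trans h

/-- Given the other coordinates, the first is confined to two points. Absence of atoms matters
because the test also rejects at equality with its threshold. -/
theorem gaussianSeq_plugInStat_eq {d : ℕ} {σ : ℝ} (hσ : 0 < σ) (hd : d ≠ 0) (v : Fin d → ℝ)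
    (t : ℝ) : gaussianSeq σ v {x | plugInStat σ x = t} = 0 := by
  obtain ⟨n, rfl⟩ := Nat.exists_eq_succ_of_ne_zero hd
  have hv : (σ ^ 2).toNNReal ≠ 0 := by simp [hσ.ne']
  have hm : MeasurableSet {x : Fin (n + 1) → ℝ | plugInStat σ x = t} :=
    measurable_plugInStat σ (measurableSet_singleton t)
  rw [← lintegral_indicator_one hm]
  have hf : Measurable ({x : Fin (n + 1) → ℝ | plugInStat σ x = t}.indicator
      (1 : (Fin (n + 1) → ℝ) → ℝ≥0∞)) :=
    measurable_one.indicator hm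
  unfold gaussianSeq
  rw [lintegral_pi_succ _ hf, lintegral_lintegral_swap (f := fun a y =>
    {x : Fin (n + 1) → ℝ | plugInStat σ x = t}.indicator (1 : (Fin (n + 1) → ℝ) → ℝ≥0∞)
      (Fin.cons a y)) (hf.comp measurable_finCons).aemeasurable]
  refine (lintegral_congr fun y => ?_).trans lintegral_zero
  set m : ℝ := t + ∫ y, l1norm y ∂(gaussianSeq σ (0 : Fin (n + 1) → ℝ)) - l1norm y with hmdef
  have hnull : gaussianReal (v 0) (σ ^ 2).toNNReal ({m, -m} : Set ℝ) = 0 := by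
    refine gaussianReal_absolutelyContinuous _ hv ?_
    exact (Set.toFinite _).measure_zero _
  have hae : ∀ᵐ a ∂(gaussianReal (v 0) (σ ^ 2).toNNReal), a ∉ ({m, -m} : Set ℝ) :=
    measure_eq_zero_iff_ae_notMem.1 hnull
  refine (lintegral_congr_ae ?_).trans lintegral_zero
  filter_upwards [hae] with a ha
  rw [Set.indicator_of_notMem]
  intro h
  have h' : plugInStat σ (Fin.cons a y : Fin (n + 1) → ℝ) = t := h
  refine ha ?_
  have e : l1norm (Fin.cons a y : Fin (n + 1) → ℝ) = |a| + l1norm y := by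
    simp [l1norm, Fin.sum_univ_succ]
  have e2 : |a| = m := by
    unfold plugInStat at h'
    rw [e] at h'
    rw [hmdef]; linarith
  rcases abs_choice a with h | h
  · left; linarith
  · right; change a = -m; linarith

/-! ### Quantiles and the calibrated test -/

theorem bddBelow_quantile_set {d : ℕ} {q : ℝ} (hq : 0 < q) (σ : ℝ) (v : Fin d → ℝ) :
    BddBelow {t : ℝ | ENNReal.ofReal q ≤ gaussianSeq σ v {x | plugInStat σ x ≤ t}} := by
  refine ⟨-∫ y, l1norm y ∂(gaussianSeq σ (0 : Fin d → ℝ)), fun t ht => ?_⟩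
  by_contra hlt
  push Not at hlt
  have : {x : Fin d → ℝ | plugInStat σ x ≤ t} = ∅ := by
    ext x
    simp only [Set.mem_empty_iff_false, iff_false]
    intro hx
    have hx' : plugInStat σ x ≤ t := hx
    have : 0 ≤ l1norm x := Finset.sum_nonneg fun _ _ => abs_nonneg _
    unfold plugInStat at hx'
    linarith
  have ht' : ENNReal.ofReal q ≤ gaussianSeq σ v {x | plugInStat σ x ≤ t} := ht
  rw [this, measure_empty, nonpos_iff_eq_zero, ENNReal.ofReal_eq_zero] at ht'
  linarith

theorem ofReal_one_sub_le_gaussianSeq_iff {d : ℕ} (σ : ℝ) (v : Fin d → ℝ) {α t : ℝ} (hα : 0 < α) :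
    ENNReal.ofReal (1 - α) ≤ gaussianSeq σ v {x | plugInStat σ x ≤ t} ↔
      gaussianSeq σ v {x | t < plugInStat σ x} ≤ ENNReal.ofReal α := by
  have hm : MeasurableSet {x : Fin d → ℝ | plugInStat σ x ≤ t} :=
    measurableSet_le (measurable_plugInStat σ) measurable_const
  have hc : {x : Fin d → ℝ | t < plugInStat σ x} = {x | plugInStat σ x ≤ t}ᶜ := by
    ext x; exact (not_le (a := plugInStat σ x)).symm
  rw [hc, ← ofReal_measureReal, ← ofReal_measureReal,
    ENNReal.ofReal_le_ofReal_iff measureReal_nonneg, ENNReal.ofReal_le_ofReal_iff hα.le,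
    probReal_compl_eq_one_sub hm]
  constructor <;> intro <;> linarith

theorem quantile_plugInStat_le {d : ℕ} {σ : ℝ} (v : Fin d → ℝ) {α c : ℝ} (hα : 0 < α)
    (hα1 : α < 1) (hc : 0 < c) (h : d * σ ^ 2 ≤ α * c ^ 2) :
    quantile (1 - α) (plugInStat σ) (gaussianSeq σ v) ≤ l1norm v + c := by
  refine csInf_le (bddBelow_quantile_set (by linarith) σ v) ?_
  refine (ofReal_one_sub_le_gaussianSeq_iff σ v hα).2 ?_
  refine (measure_mono fun x hx => ?_).trans (gaussianSeq_abs_sub_integral_ge_le σ v hc h)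
  have hx' : l1norm v + c < plugInStat σ x := hx
  have := integral_plugInStat_le σ v
  refine le_trans ?_ (le_abs_self (plugInStat σ x - _))
  linarith

theorem gaussianSeq_quantile_le_plugInStat {d : ℕ} {σ : ℝ} (hσ : 0 < σ) (hd : d ≠ 0)
    (v : Fin d → ℝ) {α : ℝ} (hα : 0 < α) (hα1 : α < 1) :
    gaussianSeq σ v {x | quantile (1 - α) (plugInStat σ) (gaussianSeq σ v) ≤ plugInStat σ x} ≤
      ENNReal.ofReal α := by
  set q := quantile (1 - α) (plugInStat σ) (gaussianSeq σ v) with hq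
  -- Nonemptiness excludes the default value of `sInf`. The shift `c` is a crude Chebyshev radius:
  -- `d * σ ^ 2 = α * (c - 1) ≤ α * c ^ 2`.
  have hne :
      {t : ℝ | ENNReal.ofReal (1 - α) ≤ gaussianSeq σ v {x | plugInStat σ x ≤ t}}.Nonempty := by
    set c : ℝ := (d * σ ^ 2 / α) + 1 with hc
    have hc1 : 1 ≤ c := by rw [hc]; linarith [show 0 ≤ d * σ ^ 2 / α by positivity]
    refine ⟨l1norm v + c, (ofReal_one_sub_le_gaussianSeq_iff σ v hα).2 ?_⟩
    refine (measure_mono fun x hx => ?_).trans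
      (gaussianSeq_abs_sub_integral_ge_le σ v (c := c) (by linarith) ?_)
    · have hx' : l1norm v + c < plugInStat σ x := hx
      have := integral_plugInStat_le σ v
      refine le_trans ?_ (le_abs_self (plugInStat σ x - _))
      linarith
    · have h1 : d * σ ^ 2 = α * (c - 1) := by rw [hc]; field_simp; ring
      rw [h1]
      gcongr
      nlinarith
  have hgt : ∀ t, q < t → gaussianSeq σ v {x | t < plugInStat σ x} ≤ ENNReal.ofReal α := by
    intro t ht
    obtain ⟨s, hs, hst⟩ := exists_lt_of_csInf_lt hne ht
    refine (measure_mono fun x hx => ?_).trans ((ofReal_one_sub_le_gaussianSeq_iff σ v hα).1 hs)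
    exact hst.trans hx
  -- The infimum itself satisfies the tail bound, by continuity from below along `q + 1 / (n + 1)`.
  have hU : gaussianSeq σ v {x | q < plugInStat σ x} ≤ ENNReal.ofReal α := by
    have e : {x : Fin d → ℝ | q < plugInStat σ x} =
        ⋃ n : ℕ, {x | q + 1 / ((n : ℝ) + 1) < plugInStat σ x} := by
      ext x
      simp only [Set.mem_iUnion]
      constructor
      · intro hx
        have hx' : q < plugInStat σ x := hx
        obtain ⟨n, hn⟩ := exists_nat_one_div_lt (sub_pos.2 hx')
        exact ⟨n, show q + 1 / ((n : ℝ) + 1) < plugInStat σ x by linarith⟩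
      · rintro ⟨n, hn⟩
        have hn' : q + 1 / ((n : ℝ) + 1) < plugInStat σ x := hn
        have : (0 : ℝ) < 1 / ((n : ℝ) + 1) := by positivity
        exact show q < plugInStat σ x by linarith
    have hmono : Monotone fun n : ℕ =>
        {x : Fin d → ℝ | q + 1 / ((n : ℝ) + 1) < plugInStat σ x} := by
      intro m n hmn x hx
      have : 1 / ((n : ℝ) + 1) ≤ 1 / ((m : ℝ) + 1) := by gcongr
      exact lt_of_le_of_lt (by linarith) (show q + 1 / ((m : ℝ) + 1) < plugInStat σ x from hx)
    rw [e, hmono.measure_iUnion]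
    exact iSup_le fun n => hgt _ (by linarith [show (0 : ℝ) < 1 / ((n : ℝ) + 1) by positivity])
  calc _ ≤ gaussianSeq σ v ({x | q < plugInStat σ x} ∪ {x | plugInStat σ x = q}) :=
        measure_mono fun x (hx : q ≤ plugInStat σ x) => hx.lt_or_eq.imp id Eq.symm
    _ ≤ _ := measure_union_le _ _
    _ ≤ ENNReal.ofReal α := by rw [gaussianSeq_plugInStat_eq hσ hd, add_zero]; exact hU

theorem plugInThreshold_le {d : ℕ} {σ ε₀ α c : ℝ} (hε₀ : 0 ≤ ε₀) (hα : 0 < α) (hα1 : α < 1)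
    (hc : 0 < c) (h : d * σ ^ 2 ≤ α * c ^ 2) : plugInThreshold d σ α ε₀ ≤ ε₀ + c := by
  refine csSup_le ⟨_, 0, by simpa [l1norm] using hε₀, rfl⟩ ?_
  rintro t ⟨v, hv, rfl⟩
  linarith [quantile_plugInStat_le v hα hα1 hc h]

theorem isValidTest_plugInTest {d : ℕ} (hd : d ≠ 0) {σ α : ℝ} (ε₀ : ℝ) (hσ : 0 < σ) (hα : 0 < α)
    (hα1 : α < 1) : IsValidTest σ α ε₀ (plugInTest d σ α ε₀) := by
  classical
  refine ⟨Measurable.ite (measurableSet_le measurable_const (measurable_plugInStat σ))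
    measurable_const measurable_const, fun v hv => ?_⟩
  refine (measure_mono fun x hx => ?_).trans
    (gaussianSeq_quantile_le_plugInStat hσ hd v hα hα1)
  have hx1 : plugInThreshold d σ α ε₀ ≤ plugInStat σ x := by
    by_contra hcon
    have hx' : plugInTest d σ α ε₀ x = 1 := hx
    simp [plugInTest, hcon] at hx'
  refine le_trans ?_ hx1
  set c : ℝ := (d * σ ^ 2 / α) + 1 with hc
  have hc1 : 1 ≤ c := by rw [hc]; linarith [show 0 ≤ d * σ ^ 2 / α by positivity]
  -- Without an upper bound on the quantiles over the null, `sSup` need not dominate them.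
  refine le_csSup ⟨ε₀ + c, ?_⟩ ⟨v, hv, rfl⟩
  rintro t ⟨v', hv', rfl⟩
  have h1 : d * σ ^ 2 = α * (c - 1) := by rw [hc]; field_simp; ring
  have h2 : d * σ ^ 2 ≤ α * c ^ 2 := by
    rw [h1]
    gcongr
    nlinarith
  linarith [quantile_plugInStat_le v' hα hα1 (by linarith) h2]

/-! ### Power of the plug-in test. -/

theorem exists_testRisk_plugInTest_lt {α β a b : ℝ} (hα : 0 < α) (hβ : 0 < β) (hα1 : α < 1)
    (ha : 0 < a) (hb : 0 < b) : ∃ C : ℝ, 0 < C ∧ ∀ d : ℕ, 2 ≤ d → ∀ σ : ℝ, 0 < σ → ∀ ε₀ : ℝ,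
      a * (σ * √d) ≤ ε₀ → ε₀ ≤ b * (σ * d) → ∀ ε₁ : ℝ, C * √(ε₀ * (σ * d)) ≤ ε₁ - ε₀ →
        testRisk σ ε₁ (plugInTest d σ α ε₀) < ENNReal.ofReal β := by
  obtain ⟨c, hc, H⟩ := exists_mul_le_integral_abs_sub
  -- `A * ε₀` and `B * ε₀` are Chebyshev radii at levels `α` and `β / 2`, using `a * (σ * √d) ≤ ε₀`.
  -- Level `β / 2` makes the risk strictly below `β`.
  obtain ⟨A, hA⟩ : ∃ A, A = 1 / (a * √α) := ⟨_, rfl⟩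
  obtain ⟨B, hB⟩ : ∃ B, B = 1 / (a * √(β / 2)) := ⟨_, rfl⟩
  have hA0 : 0 < A := by rw [hA]; positivity
  have hB0 : 0 < B := by rw [hB]; positivity
  obtain ⟨θ, hθ, hθ0, hθ1⟩ : ∃ θ, θ = 1 / (1 + √b) ∧ 0 < θ ∧ θ * √b ≤ 1 := by
    refine ⟨_, rfl, by positivity, ?_⟩
    rw [div_mul_eq_mul_div, one_mul, div_le_one (by positivity)]
    linarith
  obtain ⟨C, hC⟩ : ∃ C, C = (θ ^ 2 + (1 + A + B) / c) / θ := ⟨_, rfl⟩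
  have hC0 : 0 < C := by rw [hC]; positivity
  refine ⟨C, hC0, fun d hd σ hσ ε₀ hε₀a hε₀b ε₁ hε₁ => ?_⟩
  have hd0 : (0 : ℝ) < d := by
    have : (2 : ℝ) ≤ d := by exact_mod_cast hd
    linarith
  have hσd : 0 < σ * d := by positivity
  have hε₀ : 0 < ε₀ := lt_of_lt_of_le (by positivity) hε₀a
  have hdev : ∀ τ : ℝ, 0 < τ → d * σ ^ 2 ≤ τ * (1 / (a * √τ) * ε₀) ^ 2 := by
    intro τ hτ
    have h1 : (a * (σ * √d)) ^ 2 ≤ ε₀ ^ 2 := by gcongr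
    rw [mul_pow, mul_pow, Real.sq_sqrt hd0.le] at h1
    have h2 : τ * (1 / (a * √τ) * ε₀) ^ 2 = ε₀ ^ 2 / a ^ 2 := by
      rw [mul_pow, div_pow, mul_pow, Real.sq_sqrt hτ.le]; field_simp
    rw [h2, le_div_iff₀ (by positivity)]
    linarith
  have hthr : plugInThreshold d σ α ε₀ ≤ ε₀ + A * ε₀ :=
    plugInThreshold_le hε₀.le hα hα1 (by positivity) (hA ▸ hdev α hα)
  obtain ⟨y, hy⟩ : ∃ y : ℝ, y = √(ε₀ * (σ * d)) := ⟨_, rfl⟩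
  rw [← hy] at hε₁
  have hy0 : 0 < y := hy ▸ Real.sqrt_pos.2 (by positivity)
  have hy2 : y ^ 2 = ε₀ * (σ * d) := by rw [hy, Real.sq_sqrt (by positivity)]
  have hyb : y ≤ √b * (σ * d) := by
    rw [hy, Real.sqrt_le_left (by positivity), mul_pow, Real.sq_sqrt hb.le]
    calc ε₀ * (σ * d) ≤ b * (σ * d) * (σ * d) := by gcongr
      _ = _ := by ring
  -- This slope turns `l * y` into `θ * ε₀` and `l ^ 2 * (σ * d)` into `θ ^ 2 * ε₀`; `C` then solves
  -- `c * (C * θ - θ ^ 2) = 1 + A + B`. The choice of `θ` ensures `l ≤ 1`.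
  obtain ⟨l, hl⟩ : ∃ l : ℝ, l = θ * y / (σ * d) := ⟨_, rfl⟩
  have hl0 : 0 < l := by rw [hl]; positivity
  have hl1 : l ≤ 1 := by
    rw [hl, div_le_one hσd]
    calc θ * y ≤ θ * (√b * (σ * d)) := by gcongr
      _ = θ * √b * (σ * d) := by ring
      _ ≤ 1 * (σ * d) := by gcongr
      _ = _ := one_mul _
  refine lt_of_le_of_lt ?_ ((ENNReal.ofReal_lt_ofReal_iff hβ).2 (half_lt_self hβ))
  refine iSup₂_le fun v hv => ?_
  have hmean : ε₀ + A * ε₀ + B * ε₀ ≤ ∫ x, plugInStat σ x ∂(gaussianSeq σ v) := by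
    have hly : l * y = θ * ε₀ := by
      rw [hl, div_mul_eq_mul_div, mul_assoc, ← sq, hy2]; field_simp
    have hll : l ^ 2 * (σ * d) = θ ^ 2 * ε₀ := by
      rw [hl, div_pow, mul_pow, hy2]; field_simp
    have hCθ : C * θ - θ ^ 2 = (1 + A + B) / c := by rw [hC]; field_simp; ring
    calc ε₀ + A * ε₀ + B * ε₀ = c * (((1 + A + B) / c) * ε₀) := by field_simp
      _ = c * (l * (C * y) - l ^ 2 * (σ * d)) := by
          rw [← hCθ, hll, mul_left_comm l C y, hly]; ring
      _ ≤ c * (l * l1norm v - l ^ 2 * (σ * d)) := by gcongr; linarith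
      _ = ∑ i, c * (l * |v i| - l ^ 2 * σ) := by
          rw [← Finset.mul_sum, Finset.sum_sub_distrib, ← Finset.mul_sum, l1norm]
          simp only [Finset.sum_const, Finset.card_univ, Fintype.card_fin, nsmul_eq_mul]
          ring
      _ ≤ _ := by
          rw [integral_plugInStat]
          exact Finset.sum_le_sum fun i _ => H σ hσ (v i) l hl0.le hl1
  refine (measure_mono fun x hx => ?_).trans (gaussianSeq_abs_sub_integral_ge_le σ v
    (c := B * ε₀) (by positivity) (hB ▸ hdev (β / 2) (half_pos hβ)))
  have hx1 : plugInStat σ x < plugInThreshold d σ α ε₀ := by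
    by_contra hcon
    have hx' : plugInTest d σ α ε₀ x = 0 := hx
    simp [plugInTest, not_lt.1 hcon] at hx'
  change B * ε₀ ≤ |_|
  rw [abs_sub_comm]
  refine le_trans ?_ (le_abs_self _)
  linarith

/-! ### The critical separation in both regimes. -/

theorem bddBelow_separation_set (d : ℕ) (σ α β ε₀ : ℝ) :
    BddBelow {s : ℝ | ∃ ε₁ : ℝ, ε₀ ≤ ε₁ ∧ minimaxRisk d σ α ε₀ ε₁ < ENNReal.ofReal β ∧
      s = ε₁ - ε₀} :=
  ⟨0, by rintro s ⟨ε₁, h, _, rfl⟩; linarith⟩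

theorem exists_interpolation_bounds {α β a b : ℝ} (hα : 0 < α) (hβ : 0 < β) (hαβ : α + β < 1)
    (ha : 0 < a) (hb : 0 < b) : ∃ C : ℝ, 0 < C ∧ ∀ d : ℕ, 2 ≤ d → ∀ σ : ℝ, 0 < σ → ∀ ε₀ : ℝ,
      a * (σ * √d) ≤ ε₀ → ε₀ ≤ b * (σ * d) →
        √(ε₀ * (σ * d)) ≤ C * Real.log d ^ 3 * criticalSeparation d σ α β ε₀ ∧
        criticalSeparation d σ α β ε₀ ≤ C * √(ε₀ * (σ * d)) ∧
        IsValidTest σ α ε₀ (plugInTest d σ α ε₀) ∧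
        ∀ ε₁ : ℝ, C * √(ε₀ * (σ * d)) ≤ ε₁ - ε₀ →
          testRisk σ ε₁ (plugInTest d σ α ε₀) < ENNReal.ofReal β := by
  obtain ⟨C₁, hC₁, H₁⟩ := exists_sqrt_le_mul_sub hα hβ hαβ hb
  obtain ⟨C₂, hC₂, H₂⟩ := exists_testRisk_plugInTest_lt hα hβ (by linarith) ha hb
  refine ⟨C₁ + C₂, by positivity, fun d hd σ hσ ε₀ hε₀a hε₀b => ?_⟩
  have hd2 : (2 : ℝ) ≤ d := by exact_mod_cast hd
  have hd0 : (0 : ℝ) < d := by linarith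
  have hε₀ : 0 < ε₀ := lt_of_lt_of_le (by positivity) hε₀a
  have hlog : 0 < Real.log d := Real.log_pos (by linarith)
  have hvalid : IsValidTest σ α ε₀ (plugInTest d σ α ε₀) :=
    isValidTest_plugInTest (by omega) ε₀ hσ hα (by linarith)
  have hy0 : 0 ≤ √(ε₀ * (σ * d)) := Real.sqrt_nonneg _
  -- Besides the upper bound, this gives nonemptiness, without which the infimum would default to
  -- `0` and the lower bound would fail.
  have hmem : C₂ * √(ε₀ * (σ * d)) ∈ {s : ℝ | ∃ ε₁ : ℝ, ε₀ ≤ ε₁ ∧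
      minimaxRisk d σ α ε₀ ε₁ < ENNReal.ofReal β ∧ s = ε₁ - ε₀} := by
    refine ⟨ε₀ + C₂ * √(ε₀ * (σ * d)), by linarith [mul_nonneg hC₂.le hy0], ?_, by ring⟩
    exact lt_of_le_of_lt (iInf₂_le _ hvalid) (H₂ d hd σ hσ ε₀ hε₀a hε₀b _ (by linarith))
  refine ⟨?_, ?_, hvalid, fun ε₁ hε₁ => H₂ d hd σ hσ ε₀ hε₀a hε₀b ε₁
    (by linarith [mul_nonneg hC₁.le hy0])⟩
  · rw [← div_le_iff₀' (by positivity)]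
    refine le_csInf ⟨_, hmem⟩ ?_
    rintro s ⟨ε₁, hε₁, hrisk, rfl⟩
    rw [div_le_iff₀' (by positivity)]
    refine (H₁ d hd σ hσ ε₀ hε₀ hε₀b ε₁ hε₁ hrisk).trans ?_
    gcongr
    linarith
  · refine (csInf_le (bddBelow_separation_set d σ α β ε₀) hmem).trans ?_
    gcongr
    linarith

end TolerantTesting

theorem mainTheorem1 :
    ∃ κ : ℕ, ∀ α β : ℝ, 0 < α → 0 < β → α + β < 1 → ∀ a b : ℝ, 0 < a → 0 < b →
      ∃ C : ℝ, 0 < C ∧ ∀ d : ℕ, 2 ≤ d → ∀ σ : ℝ, 0 < σ → σ ≤ 1 → ∀ ε₀ : ℝ,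
        -- interpolation regime
        (a * (σ * √(d : ℝ)) ≤ ε₀ → ε₀ ≤ b * (σ * d) →
          √(ε₀ * (σ * d)) ≤
              C * Real.log d ^ κ * TolerantTesting.criticalSeparation d σ α β ε₀ ∧
          TolerantTesting.criticalSeparation d σ α β ε₀ ≤ C * √(ε₀ * (σ * d)) ∧
          TolerantTesting.IsValidTest σ α ε₀ (TolerantTesting.plugInTest d σ α ε₀) ∧
          ∀ ε₁ : ℝ, C * √(ε₀ * (σ * d)) ≤ ε₁ - ε₀ →
            TolerantTesting.testRisk σ ε₁ (TolerantTesting.plugInTest d σ α ε₀) <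
              ENNReal.ofReal β) ∧
        -- functional estimation regime
        (a * (σ * d) ≤ ε₀ → ε₀ ≤ b * (σ * d) →
          σ * d ≤ C * Real.log d ^ κ * TolerantTesting.criticalSeparation d σ α β ε₀ ∧
          TolerantTesting.criticalSeparation d σ α β ε₀ ≤ C * (σ * d) ∧
          TolerantTesting.IsValidTest σ α ε₀ (TolerantTesting.plugInTest d σ α ε₀) ∧
          ∀ ε₁ : ℝ, C * (σ * d) ≤ ε₁ - ε₀ →
            TolerantTesting.testRisk σ ε₁ (TolerantTesting.plugInTest d σ α ε₀) <
              ENNReal.ofReal β) := by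
  refine ⟨3, fun α β hα hβ hαβ a b ha hb => ?_⟩
  obtain ⟨C, hC, H⟩ := TolerantTesting.exists_interpolation_bounds hα hβ hαβ ha hb
  have hsa : 0 < √a := Real.sqrt_pos.2 ha
  have hsb : 0 < √b := Real.sqrt_pos.2 hb
  refine ⟨C * (1 + √b + 1 / √a), by positivity, fun d hd σ hσ _ ε₀ => ?_⟩
  have hd2 : (2 : ℝ) ≤ d := by exact_mod_cast hd
  have hd0 : (0 : ℝ) < d := by linarith
  have hσd : 0 < σ * d := by positivity
  have hlog : 0 ≤ Real.log d ^ 3 := pow_nonneg (Real.log_nonneg (by linarith)) 3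
  have hs : 0 ≤ TolerantTesting.criticalSeparation d σ α β ε₀ :=
    Real.sInf_nonneg (by rintro s ⟨ε₁, h, _, rfl⟩; linarith)
  have hC1 : C ≤ C * (1 + √b + 1 / √a) :=
    le_mul_of_one_le_right hC.le (by linarith [show 0 < 1 / √a by positivity])
  refine ⟨fun h1 h2 => ?_, fun h1 h2 => ?_⟩
  · obtain ⟨L, U, V, T⟩ := H d hd σ hσ ε₀ h1 h2
    have hCy : C * √(ε₀ * (σ * d)) ≤ C * (1 + √b + 1 / √a) * √(ε₀ * (σ * d)) := by gcongr
    exact ⟨L.trans (by gcongr), U.trans hCy, V, fun ε₁ h => T ε₁ (hCy.trans h)⟩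
  -- Here `√(ε₀ * (σ * d))` lies between `√a * (σ * d)` and `√b * (σ * d)`, and `√d ≤ d` places `ε₀`
  -- in the interpolation regime.
  · have hsqrt : √(d : ℝ) ≤ d := by
      rw [Real.sqrt_le_left hd0.le]; nlinarith
    obtain ⟨L, U, V, T⟩ := H d hd σ hσ ε₀ (le_trans (by gcongr) h1) h2
    have hlow : √a * (σ * d) ≤ √(ε₀ * (σ * d)) := by
      refine Real.le_sqrt_of_sq_le ?_
      rw [mul_pow, Real.sq_sqrt ha.le, sq, ← mul_assoc]
      gcongr
    have hup : √(ε₀ * (σ * d)) ≤ √b * (σ * d) := by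
      rw [Real.sqrt_le_left (by positivity), mul_pow, Real.sq_sqrt hb.le, sq, ← mul_assoc]
      linarith [mul_le_mul_of_nonneg_right h2 hσd.le]
    have hCy : C * √(ε₀ * (σ * d)) ≤ C * (1 + √b + 1 / √a) * (σ * d) := by
      calc _ ≤ C * (√b * (σ * d)) := by gcongr
        _ = C * √b * (σ * d) := by ring
        _ ≤ _ := by
            gcongr
            linarith [show 0 < 1 / √a by positivity]
    refine ⟨?_, U.trans hCy, V, fun ε₁ h => T ε₁ (hCy.trans h)⟩
    calc σ * d = 1 / √a * (√a * (σ * d)) := by field_simp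
      _ ≤ 1 / √a * (C * Real.log d ^ 3 * TolerantTesting.criticalSeparation d σ α β ε₀) := by
          exact mul_le_mul_of_nonneg_left (hlow.trans L) (by positivity)
      _ = C * (1 / √a) * Real.log d ^ 3 * TolerantTesting.criticalSeparation d σ α β ε₀ := by ring
      _ ≤ _ := by
          gcongr
          linarith
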